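/- Let $V_1\subseteq V_2$ be transitive models of ZFC (sets or proper classes) such that every ordinal of $V_2$ belongs to $V_1$. Suppose that $\kappa$ is a regular cardinal $>\aleph_0$ in $V_1$, that $\kappa$ is still a cardinal in $V_2$, and that $\operatorname{cf}^{V_2}(\kappa)=\theta<\kappa$. For an ordinal $\delta$ and $i\in\{1,2\}$ let $\mathrm{Club}^{V_i}(\delta)$ be the set of closed unbounded subsets of $\delta$ that belong to $V_i$, and let $\operatorname{cf}^{V_2}(\mathrm{Club}(\theta),\supseteq)$ be the least cardinality, computed in $V_2$, of a family $P\in V_2$, $P\subseteq\mathrm{Club}^{V_2}(\theta)$, such that every $E\in\mathrm{Club}^{V_2}(\theta)$ includes some $D\in P$. Assume that one of the following holds. 1. $\theta>\aleph_0$, and for every $a\in V_2$ with $a\subseteq\mathrm{Club}^{V_1}(\kappa)$ and $|a|^{V_2}\le\operatorname{cf}^{V_2}(\mathrm{Club}(\theta),\supseteq)$ there is a sequence $\langle b_i: i<\theta\rangle\in V_2$ such that $b_i\in V_1$ and $|b_i|^{V_1}\le\kappa$ for every $i<\theta$, and $a\subseteq\bigcup_{i<\theta}b_i$. 2. $\theta=\aleph_0$;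 $2^{\aleph_0}<\kappa$ holds in $V_2$; and for every $a\in V_2$ with $a\subseteq\mathrm{Club}^{V_1}(\kappa)$ and $|a|^{V_2}\le(2^{\theta})^{V_2}$ there is $b\in V_1$ with $a\subseteq b$ and $|b|^{V_1}\le\kappa$. Then there is an unbounded set $C^*\subseteq\kappa$ with $C^*\in V_2$ such that $C^*\setminus E$ is bounded in $\kappa$ for every $E\in\mathrm{Club}^{V_1}(\kappa)$. -/

import Mathlib

universe u

namespace InnerModels

/-! ### Transitive models of ZFC -/

/-- The relation symbols of the language of set theory: one binary symbol. -/
inductive MemRel : ℕ → Type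
  | mem : MemRel 2

/-- The first-order language `{∈}` of set theory (equality is a logical symbol). -/
def setLang : FirstOrder.Language.{0, 0} := ⟨fun _ => Empty, MemRel⟩

/-- A class `V` of sets as a first-order structure `(V, ∈)`. -/
instance memStructure (V : Set ZFSet.{u}) : setLang.Structure V where
  funMap := fun f => f.elim
  RelMap := fun r x => match r with
    | .mem => (x 0 : ZFSet.{u}) ∈ (x 1 : ZFSet.{u})

/-- The structure `(V, ∈)` satisfies every axiom of ZFC. All quantifiers range over `V`; the
axiom schemes of separation and replacement range over the classes, respectively class relations,
that are definable over `(V, ∈)` by a first-order formula with parameters from `V`. -/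
structure ModelsZFC (V : Set ZFSet.{u}) : Prop where
  nonempty : Nonempty V
  extensionality : ∀ x y : V, (∀ z : V, z.1 ∈ x.1 ↔ z.1 ∈ y.1) → x = y
  foundation : ∀ x : V, (∃ y : V, y.1 ∈ x.1) →
    ∃ y : V, y.1 ∈ x.1 ∧ ∀ z : V, z.1 ∈ x.1 → z.1 ∉ y.1
  pairing : ∀ x y : V, ∃ p : V, ∀ z : V, z.1 ∈ p.1 ↔ z = x ∨ z = y
  union : ∀ x : V, ∃ s : V, ∀ z : V, z.1 ∈ s.1 ↔ ∃ y : V, y.1 ∈ x.1 ∧ z.1 ∈ y.1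
  powerset : ∀ x : V, ∃ p : V, ∀ z : V, z.1 ∈ p.1 ↔ ∀ w : V, w.1 ∈ z.1 → w.1 ∈ x.1
  infinity : ∃ x : V, (∃ e : V, (∀ z : V, z.1 ∉ e.1) ∧ e.1 ∈ x.1) ∧
    ∀ y : V, y.1 ∈ x.1 → ∃ s : V, (∀ z : V, z.1 ∈ s.1 ↔ z.1 ∈ y.1 ∨ z = y) ∧ s.1 ∈ x.1
  separation : ∀ D : Set V, (Set.univ : Set V).Definable₁ setLang D →
    ∀ a : V, ∃ b : V, ∀ z : V, z.1 ∈ b.1 ↔ z.1 ∈ a.1 ∧ z ∈ D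
  replacement : ∀ F : Set (V × V), (Set.univ : Set V).Definable₂ setLang F →
    ∀ a : V, (∀ x : V, x.1 ∈ a.1 → ∃! y : V, (x, y) ∈ F) →
      ∃ b : V, ∀ y : V, y.1 ∈ b.1 ↔ ∃ x : V, x.1 ∈ a.1 ∧ (x, y) ∈ F
  choice : ∀ x : V, (∀ y : V, y.1 ∈ x.1 → ∃ z : V, z.1 ∈ y.1) →
    (∀ y y' : V, y.1 ∈ x.1 → y'.1 ∈ x.1 → y ≠ y' → ∀ z : V, ¬ (z.1 ∈ y.1 ∧ z.1 ∈ y'.1)) →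
    ∃ c : V, ∀ y : V, y.1 ∈ x.1 → ∃! z : V, z.1 ∈ y.1 ∧ z.1 ∈ c.1

/-- `V` is a transitive model of ZFC (a set model or a proper class). -/
structure IsTransitiveModel (V : Set ZFSet.{u}) : Prop where
  transitive : ∀ x ∈ V, ∀ y ∈ x, y ∈ V
  models : ModelsZFC V

/-! ### Cardinality and cofinality computed in a model -/

/-- `V ⊨ |x| ≤ |y|`: some injection from `x` to `y` belongs to `V`. -/
def CardLE (V : Set ZFSet.{u}) (x y : ZFSet.{u}) : Prop :=
  ∃ f ∈ V, ZFSet.IsFunc x y f ∧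
    ∀ s t z : ZFSet.{u}, ZFSet.pair s z ∈ f → ZFSet.pair t z ∈ f → s = t

/-- `V ⊨ |x| < |y|`. -/
def CardLT (V : Set ZFSet.{u}) (x y : ZFSet.{u}) : Prop :=
  CardLE V x y ∧ ¬ CardLE V y x

/-- `V ⊨ "κ is a cardinal"`: an ordinal that does not inject in `V` into a smaller ordinal. -/
def IsCardinalIn (V : Set ZFSet.{u}) (κ : ZFSet.{u}) : Prop :=
  κ ∈ V ∧ κ.IsOrdinal ∧ ∀ α ∈ κ, ¬ CardLE V κ α

/-- Some function from `η` to `κ` whose range is cofinal in `κ` belongs to `V`. For ordinals,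
`α ⊆ γ` says `α ≤ γ`. -/
def HasCofinalMap (V : Set ZFSet.{u}) (κ η : ZFSet.{u}) : Prop :=
  ∃ f ∈ V, ZFSet.IsFunc η κ f ∧ ∀ α ∈ κ, ∃ β γ : ZFSet.{u}, ZFSet.pair β γ ∈ f ∧ α ⊆ γ

/-- `V ⊨ cf(κ) = θ`: `θ` is the least ordinal which is mapped cofinally into `κ` in `V`. -/
def IsCofIn (V : Set ZFSet.{u}) (κ θ : ZFSet.{u}) : Prop :=
  θ.IsOrdinal ∧ HasCofinalMap V κ θ ∧ ∀ η ∈ θ, ¬ HasCofinalMap V κ η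

/-- `V ⊨ "κ is a regular cardinal > ℵ₀"`. -/
def IsRegularUncountableIn (V : Set ZFSet.{u}) (κ : ZFSet.{u}) : Prop :=
  IsCardinalIn V κ ∧ ZFSet.omega ∈ κ ∧ IsCofIn V κ κ

/-- The power set of `x` in `V`, for `x ∈ V`. -/
noncomputable def powersetIn (V : Set ZFSet.{u}) (x : ZFSet.{u}) : ZFSet.{u} :=
  ZFSet.sep (fun y => y ∈ V) (ZFSet.powerset x)

/-! ### Clubs -/

/-- `C` is an unbounded subset of the limit ordinal `κ`. -/
def IsUnboundedIn (C κ : ZFSet.{u}) : Prop :=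
  C ⊆ κ ∧ ∀ α ∈ κ, ∃ β ∈ C, α ∈ β

/-- `E` is a closed unbounded subset of the limit ordinal `κ`. A nonempty `δ ∈ κ` in which
`E ∩ δ` has, above each `α ∈ δ`, a further element is a limit point of `E`. -/
def IsClub (E κ : ZFSet.{u}) : Prop :=
  IsUnboundedIn E κ ∧
    ∀ δ ∈ κ, δ.Nonempty → (∀ α ∈ δ, ∃ β ∈ E, β ∈ δ ∧ α ∈ β) → δ ∈ E

/-- The clubs of `κ` that belong to `V`. (Being a club is absolute for transitive classes, so
these are the clubs in the sense of `V`.) -/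
def ClubsOf (V : Set ZFSet.{u}) (κ : ZFSet.{u}) : Set ZFSet.{u} :=
  {E | E ∈ V ∧ IsClub E κ}

/-- `P ∈ V` is a set of clubs of `θ` that is cofinal, in `V`, in the clubs of `θ` ordered by
reverse inclusion. -/
def IsCofinalClubFamily (V : Set ZFSet.{u}) (θ P : ZFSet.{u}) : Prop :=
  P ∈ V ∧ (∀ E ∈ P, E ∈ ClubsOf V θ) ∧ ∀ E ∈ ClubsOf V θ, ∃ D ∈ P, D ⊆ E

/-- `V ⊨ cf(Club(θ), ⊇) = μ`: `μ` is the least cardinality, in `V`, of a cofinal family. -/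
def IsClubCofinality (V : Set ZFSet.{u}) (θ μ : ZFSet.{u}) : Prop :=
  IsCardinalIn V μ ∧
    (∃ P, IsCofinalClubFamily V θ P ∧ CardLE V P μ) ∧
    ∀ P, IsCofinalClubFamily V θ P → CardLE V μ P

/-! ### The covering hypotheses -/

/-- Every `a ∈ V₂` that consists of clubs of `κ` from `V₁` and has size at most
`cf(Club(θ), ⊇)` in `V₂` is covered by the union of a sequence `⟨b_i : i < θ⟩ ∈ V₂` of sets
`b_i ∈ V₁` of size at most `κ` in `V₁`. The sequence is a function `g ∈ V₂` with domain `θ`. -/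
def SequenceCovering (V₁ V₂ : Set ZFSet.{u}) (κ θ : ZFSet.{u}) : Prop :=
  ∀ μ, IsClubCofinality V₂ θ μ →
    ∀ a ∈ V₂, (∀ E ∈ a, E ∈ ClubsOf V₁ κ) → CardLE V₂ a μ →
      ∃ B ∈ V₂, ∃ g ∈ V₂, ZFSet.IsFunc θ B g ∧
        (∀ i b : ZFSet.{u}, ZFSet.pair i b ∈ g → b ∈ V₁ ∧ CardLE V₁ b κ) ∧
        ∀ E ∈ a, ∃ i b : ZFSet.{u}, ZFSet.pair i b ∈ g ∧ E ∈ b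

/-- Every `a ∈ V₂` that consists of clubs of `κ` from `V₁` and has size at most `2^θ` in `V₂` is
covered by a set `b ∈ V₁` of size at most `κ` in `V₁`. -/
def SetCovering (V₁ V₂ : Set ZFSet.{u}) (κ θ : ZFSet.{u}) : Prop :=
  ∀ a ∈ V₂, (∀ E ∈ a, E ∈ ClubsOf V₁ κ) → CardLE V₂ a (powersetIn V₂ θ) →
    ∃ b ∈ V₁, a ⊆ b ∧ CardLE V₁ b κ

end InnerModels

/-! Both cases use that, in `V₁`, at most `κ` clubs of `κ` have a club pseudo-intersection: a
diagonal intersection of an enumeration of them is almost contained in each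
(`exists_pseudointersection`).

Uncountable `θ`. Fix in `V₂` an increasing cofinal map `A : θ → κ` and let `gsup A δ` be the
supremum of its first `δ` values. If no `C` works, then each club `D` of `θ` has a club `E_D ∈ V₁`
of `κ` that omits cofinally many points `gsup A δ`, `δ ∈ D`. Let `D` range over a smallest cofinal
family of clubs, cover the chosen `E_D` by sets `b_i`, `i < θ`, and let `F_i` be a
pseudo-intersection of `b_i`. Since `θ` is regular and uncountable in `V₂`, some club of `θ`
consists of `δ` with `gsup A δ ∈ F_i` for all `i < δ` (`exists_diagonal_club`). A member `D` of the
family inside that club has `E_D ∈ b_i` for some `i`, so `E_D` contains `gsup A δ` for all large `δ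
∈ D`, a contradiction.

Countable `θ`. Choose for each `x : ω → κ` a club `e x ∈ V₁` that omits infinitely many terms of
`x`, if there is one. Let `X ⊆ κ` contain a cofinal sequence and be closed under `x ↦ sup (e x ∩ x
n)`, with at most `2 ^ ℵ₀` sequences from `ω` to `X` (`exists_closure`). The clubs `e x` for these
`x` have a common pseudo-intersection `F`. Let `q n` be the least element of `X` with a point of `F`
between it and `A n`. If `q n ∉ e q` for a large `n`, that point lies in `e q` below `q n`; so `sup
(e q ∩ q n)` is also a candidate, and minimality makes `q n` a limit of `e q`, hence a member of it.

The models satisfy separation and replacement only for definable classes, so each construction must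
be shown definable. The classes `D` and `DT` leave this to instance search. -/

namespace InnerModels
open Set FirstOrder

/-! ### Definability over a transitive model. -/

variable {V : Set ZFSet.{u}}

/-- Prepend a value to a valuation. -/
def cons (x : ZFSet.{u}) (v : ℕ → ZFSet.{u}) : ℕ → ZFSet.{u}
  | 0 => x
  | i + 1 => v i

theorem cons_mem {x : ZFSet.{u}} {v : ℕ → ZFSet.{u}} (hx : x ∈ V) (hv : ∀ i, v i ∈ V) :
    ∀ i, cons x v i ∈ V
  | 0 => hx
  | i + 1 => hv i

/-- The predicate `P` on valuations in `V` is first-order definable over `(V, ∈)` with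
parameters. -/
class D (V : Set ZFSet.{u}) (P : (ℕ → ZFSet.{u}) → Prop) : Prop where
  out : (univ : Set V).Definable setLang {v : ℕ → V | P (fun i => (v i).1)}

theorem D.congr {P Q : (ℕ → ZFSet.{u}) → Prop} (hP : D V P)
    (h : ∀ v, (∀ i, v i ∈ V) → (P v ↔ Q v)) : D V Q := by
  constructor
  convert hP.out using 1
  ext v
  exact (h _ fun i => (v i).2).symm

theorem D.reindex {P : (ℕ → ZFSet.{u}) → Prop} (hP : D V P) (f : ℕ → ℕ) :
    D V (fun v => P (fun i => v (f i))) :=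
  ⟨hP.out.preimage_comp f⟩

instance D.true : D V (fun _ => True) := ⟨definable_univ⟩

instance D.and {P Q : (ℕ → ZFSet.{u}) → Prop} [hP : D V P] [hQ : D V Q] :
    D V (fun v => P v ∧ Q v) := ⟨hP.out.inter hQ.out⟩

instance D.or {P Q : (ℕ → ZFSet.{u}) → Prop} [hP : D V P] [hQ : D V Q] :
    D V (fun v => P v ∨ Q v) := ⟨hP.out.union hQ.out⟩

instance D.not {P : (ℕ → ZFSet.{u}) → Prop} [hP : D V P] : D V (fun v => ¬ P v) :=
  ⟨hP.out.compl⟩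

instance D.imp {P Q : (ℕ → ZFSet.{u}) → Prop} [hP : D V P] [hQ : D V Q] :
    D V (fun v => P v → Q v) :=
  D.congr (V := V) (P := fun v => ¬ P v ∨ Q v) inferInstance fun _ _ => by tauto

instance D.iff {P Q : (ℕ → ZFSet.{u}) → Prop} [hP : D V P] [hQ : D V Q] :
    D V (fun v => P v ↔ Q v) :=
  D.congr (V := V) (P := fun v => (P v → Q v) ∧ (Q v → P v)) inferInstance fun _ _ => by tauto

/-- De Bruijn convention: under a quantifier the bound variable is `v 0` and the free ones are
shifted by one. -/
instance D.exV {P : ZFSet.{u} → (ℕ → ZFSet.{u}) → Prop}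
    [hP : D V (fun v => P (v 0) (fun i => v (i + 1)))] : D V (fun v => ∃ x ∈ V, P x v) := by
  constructor
  have h := (hP.out.preimage_comp
    (fun i => Nat.casesOn i (Sum.inr 0) (fun j => Sum.inl j) : ℕ → ℕ ⊕ Fin 1)).exists_of_finite
  convert h using 1
  ext v
  constructor
  · rintro ⟨x, hx, h⟩
    exact ⟨fun _ => ⟨x, hx⟩, h⟩
  · rintro ⟨x, h⟩
    exact ⟨x 0, (x 0).2, h⟩

instance D.allV {P : ZFSet.{u} → (ℕ → ZFSet.{u}) → Prop}
    [hP : D V (fun v => P (v 0) (fun i => v (i + 1)))] : D V (fun v => ∀ x ∈ V, P x v) :=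
  D.congr (V := V) (P := fun v => ¬ ∃ x ∈ V, ¬ P x v) inferInstance fun _ _ => by push Not; rfl

theorem D.var_mem (i j : ℕ) : D V (fun v => v i ∈ v j) := by
  constructor
  refine Definable.mono (empty_definable_iff.2 ⟨(show setLang.Relations 2 from
    MemRel.mem).formula₂ (Language.Term.var i) (Language.Term.var j), ?_⟩) (empty_subset _)
  ext v
  change _ ↔ Language.Formula.Realize _ _
  rw [Language.Formula.realize_rel₂]
  rfl

theorem D.var_eq (i j : ℕ) : D V (fun v => v i = v j) := by
  constructor
  refine ⟨(Language.Term.var i).equal (Language.Term.var j), ?_⟩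
  ext v
  simp [Language.Formula.realize_equal, Subtype.ext_iff]

/-- Parameters may be substituted for all variables but the first. -/
theorem D.definable₁ {P : (ℕ → ZFSet.{u}) → Prop} (hP : D V P) (w : ℕ → V) :
    (univ : Set V).Definable₁ setLang {x : V | P (cons x.1 fun i => (w i).1)} := by
  obtain ⟨φ, hφ⟩ := hP.out
  refine ⟨φ.subst (fun i => Nat.casesOn i (Language.Term.var 0)
    fun j => (setLang.con (⟨w j, mem_univ _⟩ : (univ : Set V))).term), ?_⟩
  ext v
  have := Set.ext_iff.1 hφ (fun i => Nat.casesOn i (v 0) w)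
  simp only [mem_ofPred_eq] at this
  have e : (fun i => ((Nat.casesOn i (v 0) w : V) : ZFSet.{u}))
      = cons (v 0).1 fun i => (w i).1 := by
    funext i; cases i <;> rfl
  rw [e] at this
  refine this.trans ?_
  change φ.Realize _ ↔ Language.Formula.Realize (Language.BoundedFormula.subst φ _) v
  rw [Language.Formula.Realize, Language.Formula.Realize, Language.BoundedFormula.realize_subst]
  apply iff_of_eq
  congr 1
  funext i
  cases i
  · rfl
  · simp

theorem D.definable₂ {P : (ℕ → ZFSet.{u}) → Prop} (hP : D V P) (w : ℕ → V) :
    (univ : Set V).Definable₂ setLang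
      {p : V × V | P (cons p.1.1 (cons p.2.1 fun i => (w i).1))} := by
  obtain ⟨φ, hφ⟩ := hP.out
  refine ⟨φ.subst (fun i => Nat.casesOn i (Language.Term.var 0) fun j =>
    Nat.casesOn j (Language.Term.var 1)
    fun j => (setLang.con (⟨w j, mem_univ _⟩ : (univ : Set V))).term), ?_⟩
  ext v
  have := Set.ext_iff.1 hφ (fun i => Nat.casesOn i (v 0) fun j => Nat.casesOn j (v 1) w)
  simp only [mem_ofPred_eq] at this
  have e : (fun i => ((Nat.casesOn i (v 0) fun j => Nat.casesOn j (v 1) w : V) : ZFSet.{u}))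
      = cons (v 0).1 (cons (v 1).1 fun i => (w i).1) := by
    funext i; rcases i with _ | _ | i <;> rfl
  rw [e] at this
  refine this.trans ?_
  change φ.Realize _ ↔ Language.Formula.Realize (Language.BoundedFormula.subst φ _) v
  rw [Language.Formula.Realize, Language.Formula.Realize, Language.BoundedFormula.realize_subst]
  apply iff_of_eq
  congr 1
  funext i
  rcases i with _ | _ | i
  · rfl
  · rfl
  · simp

/-- The function `t` of valuations maps into `V`, and is first-order definable over `(V, ∈)` with
parameters. -/
class DT (V : Set ZFSet.{u}) (t : (ℕ → ZFSet.{u}) → ZFSet.{u}) : Prop where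
  mem : ∀ v, (∀ i, v i ∈ V) → t v ∈ V
  graph : D V (fun v => v 0 = t (fun i => v (i + 1)))

theorem DT.congr {s t : (ℕ → ZFSet.{u}) → ZFSet.{u}} (hs : DT V s)
    (h : ∀ v, (∀ i, v i ∈ V) → s v = t v) : DT V t :=
  ⟨fun v hv => h v hv ▸ hs.mem v hv, hs.graph.congr fun v hv => by
    rw [h _ fun i => hv (i + 1)]⟩

instance DT.var (i : ℕ) : DT V (fun v => v i) :=
  ⟨fun _ hv => hv i, D.var_eq 0 (i + 1)⟩

theorem DT.reindex {t : (ℕ → ZFSet.{u}) → ZFSet.{u}} (ht : DT V t) (f : ℕ → ℕ) :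
    DT V (fun v => t (fun i => v (f i))) :=
  ⟨fun _ hv => ht.mem _ fun i => hv (f i),
    ht.graph.reindex (fun i => Nat.casesOn i 0 (fun j => f j + 1))⟩

instance (priority := low) DT.comp {t : (ℕ → ZFSet.{u}) → ZFSet.{u}} {f : ℕ → ℕ}
    [ht : DT V t] : DT V (fun v => t (fun i => v (f i))) := ht.reindex f

/-- Substitution of a term, through the formula `∃ x, x = t ∧ P x`. -/
theorem D.bind {t : (ℕ → ZFSet.{u}) → ZFSet.{u}} (ht : DT V t)
    {P : ZFSet.{u} → (ℕ → ZFSet.{u}) → Prop}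
    (hP : D V (fun v => P (v 0) (fun i => v (i + 1)))) : D V (fun v => P (t v) v) := by
  have := ht.graph
  refine D.congr (V := V) (P := fun v => ∃ x ∈ V, x = t v ∧ P x v) D.exV fun v hv => ?_
  exact ⟨fun ⟨x, _, h, hx⟩ => h ▸ hx, fun h => ⟨_, ht.mem v hv, rfl, h⟩⟩

instance D.mem {s t : (ℕ → ZFSet.{u}) → ZFSet.{u}} [hs : DT V s] [ht : DT V t] :
    D V (fun v => s v ∈ t v) :=
  D.bind hs (P := fun x v => x ∈ t v) <| D.bind (ht.reindex (· + 1))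
    (P := fun y v => v 0 ∈ y) <| D.var_mem 1 0

instance D.eq {s t : (ℕ → ZFSet.{u}) → ZFSet.{u}} [hs : DT V s] [ht : DT V t] :
    D V (fun v => s v = t v) :=
  D.bind hs (P := fun x v => x = t v) ht.graph

@[simp]
theorem mem_powersetIn {x y : ZFSet.{u}} : y ∈ powersetIn V x ↔ y ⊆ x ∧ y ∈ V := by
  rw [powersetIn, ZFSet.mem_sep, ZFSet.mem_powerset]

variable [hV : Fact (IsTransitiveModel V)]

theorem mem_of_mem {x y : ZFSet.{u}} (hy : y ∈ x) (hx : x ∈ V) : y ∈ V :=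
  hV.out.transitive x hx y hy

/-- By transitivity of `V`, a set in `V` is determined by its elements in `V`, so a definition of
membership in `t` defines the graph of `t`. -/
theorem DT.of_mem {t : (ℕ → ZFSet.{u}) → ZFSet.{u}} (ht : ∀ v, (∀ i, v i ∈ V) → t v ∈ V)
    (h : D V (fun v => v 0 ∈ t (fun i => v (i + 1)))) : DT V t := by
  refine ⟨ht, D.congr (V := V) (P := fun v => ∀ x ∈ V, x ∈ v 0 ↔ x ∈ t (fun i => v (i + 1))) ?_ ?_⟩
  · have := h.reindex (fun i => Nat.casesOn i 0 (fun j => j + 2))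
    exact D.allV (P := fun x v => x ∈ v 0 ↔ x ∈ t (fun i => v (i + 1)))
      (hP := D.iff (P := fun v => v 0 ∈ v 1) (Q := fun v => v 0 ∈ t (fun i => v (i + 2))))
  · intro v hv
    constructor
    · intro H
      ext x
      exact ⟨fun hx => (H x (mem_of_mem hx (hv 0))).1 hx,
        fun hx => (H x (mem_of_mem hx (ht _ fun i => hv (i + 1)))).2 hx⟩
    · rintro e x -
      rw [e]

/-- Parameters: registering `c ∈ V` as a `Fact` lets `c` occur in definable terms. -/
instance DT.const {c : ZFSet.{u}} [hc : Fact (c ∈ V)] : DT V (fun _ => c) := by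
  refine ⟨fun _ _ => hc.out, ⟨(Language.Term.var 0).equal
    (setLang.con (⟨⟨c, hc.out⟩, mem_univ _⟩ : (univ : Set V))).term, ?_⟩⟩
  ext v
  simp [Language.Formula.realize_equal, Subtype.ext_iff]

/-- Closed definable terms denote elements of the model. -/
theorem mem_model (t : ZFSet.{u}) [ht : DT V (fun _ => t)] : t ∈ V := by
  obtain ⟨c⟩ := hV.out.models.nonempty
  exact ht.mem (fun _ => c.1) fun _ => c.2

instance D.exMem {t : (ℕ → ZFSet.{u}) → ZFSet.{u}} [ht : DT V t]
    {P : ZFSet.{u} → (ℕ → ZFSet.{u}) → Prop}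
    [hP : D V (fun v => P (v 0) (fun i => v (i + 1)))] : D V (fun v => ∃ x ∈ t v, P x v) :=
  D.congr (V := V) (P := fun v => ∃ x ∈ V, x ∈ t v ∧ P x v) inferInstance fun v hv =>
    ⟨fun ⟨x, _, h⟩ => ⟨x, h⟩, fun ⟨x, hx, h⟩ => ⟨x, mem_of_mem hx (ht.mem v hv), hx, h⟩⟩

instance D.allMem {t : (ℕ → ZFSet.{u}) → ZFSet.{u}} [ht : DT V t]
    {P : ZFSet.{u} → (ℕ → ZFSet.{u}) → Prop}
    [hP : D V (fun v => P (v 0) (fun i => v (i + 1)))] : D V (fun v => ∀ x ∈ t v, P x v) :=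
  D.congr (V := V) (P := fun v => ¬ ∃ x ∈ t v, ¬ P x v) inferInstance fun _ _ => by push Not; rfl

instance D.subset {s t : (ℕ → ZFSet.{u}) → ZFSet.{u}} [hs : DT V s] [ht : DT V t] :
    D V (fun v => s v ⊆ t v) :=
  D.congr (V := V) (P := fun v => ∀ x ∈ s v, x ∈ t v) inferInstance fun _ _ => Iff.rfl

instance D.nonempty {t : (ℕ → ZFSet.{u}) → ZFSet.{u}} [ht : DT V t] :
    D V (fun v => (t v).Nonempty) :=
  D.congr (V := V) (P := fun v => ∃ x ∈ t v, True) inferInstance fun _ _ => by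
    simp [ZFSet.nonempty_def]

theorem sep_mem {P : (ℕ → ZFSet.{u}) → Prop} (hP : D V P) {a : ZFSet.{u}} (ha : a ∈ V)
    {w : ℕ → ZFSet.{u}} (hw : ∀ i, w i ∈ V) : ZFSet.sep (fun z => P (cons z w)) a ∈ V := by
  obtain ⟨b, hb⟩ := hV.out.models.separation _ (hP.definable₁ fun i => ⟨w i, hw i⟩) ⟨a, ha⟩
  convert b.2
  ext z
  rw [ZFSet.mem_sep]
  constructor
  · rintro ⟨h1, h2⟩
    exact (hb ⟨z, mem_of_mem h1 ha⟩).2 ⟨h1, h2⟩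
  · intro h
    exact (hb ⟨z, mem_of_mem h b.2⟩).1 h

instance DT.sep {a : (ℕ → ZFSet.{u}) → ZFSet.{u}} [ha : DT V a]
    {P : ZFSet.{u} → (ℕ → ZFSet.{u}) → Prop}
    [hP : D V (fun v => P (v 0) (fun i => v (i + 1)))] :
    DT V (fun v => ZFSet.sep (fun z => P z v) (a v)) :=
  DT.of_mem (fun v hv => sep_mem hP (ha.mem v hv) hv) <|
    D.congr (V := V) (P := fun v => v 0 ∈ a (fun i => v (i + 1)) ∧ P (v 0) (fun i => v (i + 1)))
      inferInstance fun _ _ => by rw [ZFSet.mem_sep]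

/-- The set of all `F x` with `x ∈ a`. -/
noncomputable def img (F : ZFSet.{u} → ZFSet.{u}) (a : ZFSet.{u}) : ZFSet.{u} :=
  ZFSet.range (fun x : a => F x.1)

@[simp]
theorem mem_img {F : ZFSet.{u} → ZFSet.{u}} {a y : ZFSet.{u}} :
    y ∈ img F a ↔ ∃ x ∈ a, F x = y := by
  simp [img]

theorem img_mem {F : ZFSet.{u} → (ℕ → ZFSet.{u}) → ZFSet.{u}}
    (hF : DT V (fun v => F (v 0) (fun i => v (i + 1)))) {a : ZFSet.{u}} (ha : a ∈ V)
    {w : ℕ → ZFSet.{u}} (hw : ∀ i, w i ∈ V) : img (fun x => F x w) a ∈ V := by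
  have hD : D V (fun v => v 1 = F (v 0) (fun i => v (i + 2))) :=
    D.eq (s := fun v => v 1) (ht := hF.reindex fun i => Nat.casesOn i 0 fun j => j + 2)
  obtain ⟨b, hb⟩ := hV.out.models.replacement _ (hD.definable₂ fun i => ⟨w i, hw i⟩) ⟨a, ha⟩
    fun x _ => ⟨⟨F x w, hF.mem (cons x w) (cons_mem x.2 hw)⟩, rfl, fun y hy => Subtype.ext hy⟩
  convert b.2
  ext z
  rw [mem_img]
  constructor
  · rintro ⟨x, h1, rfl⟩
    exact (hb ⟨_, hF.mem (cons x w) (cons_mem (mem_of_mem h1 ha) hw)⟩).2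
      ⟨⟨x, mem_of_mem h1 ha⟩, h1, rfl⟩
  · intro h
    obtain ⟨x, h1, h2⟩ := (hb ⟨z, mem_of_mem h b.2⟩).1 h
    exact ⟨x, h1, h2.symm⟩

instance DT.img {a : (ℕ → ZFSet.{u}) → ZFSet.{u}} [ha : DT V a]
    {F : ZFSet.{u} → (ℕ → ZFSet.{u}) → ZFSet.{u}}
    [hF : DT V (fun v => F (v 0) (fun i => v (i + 1)))] :
    DT V (fun v => InnerModels.img (fun z => F z v) (a v)) :=
  DT.of_mem (fun v hv => img_mem hF (ha.mem v hv) hv) <| by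
    have := hF.reindex fun i => Nat.casesOn i 0 fun j => j + 2
    exact D.congr (V := V) (P := fun v => ∃ x ∈ a (fun i => v (i + 1)), F x (fun i => v (i + 1)) = v 0)
      (D.exMem (P := fun x v => F x (fun i => v (i + 1)) = v 0)
        (hP := D.eq (s := fun v => F (v 0) (fun i => v (i + 2))) (t := fun v => v 1)))
      fun v _ => by rw [mem_img]

instance DT.empty : DT V (fun _ => ∅) := by
  obtain ⟨c⟩ := hV.out.models.nonempty
  have := Fact.mk c.2
  exact DT.congr (V := V) (s := fun _ => ZFSet.sep (fun z => ¬ True) c.1) inferInstance fun _ _ => by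
    ext; simp

instance DT.upair {s t : (ℕ → ZFSet.{u}) → ZFSet.{u}} [hs : DT V s] [ht : DT V t] :
    DT V (fun v => ({s v, t v} : ZFSet.{u})) := by
  refine DT.of_mem (fun v hv => ?_) ?_
  · obtain ⟨p, hp⟩ := hV.out.models.pairing ⟨_, hs.mem v hv⟩ ⟨_, ht.mem v hv⟩
    convert p.2
    ext z
    rw [ZFSet.mem_pair]
    constructor
    · rintro (rfl | rfl)
      · exact (hp ⟨_, hs.mem v hv⟩).2 (Or.inl rfl)
      · exact (hp ⟨_, ht.mem v hv⟩).2 (Or.inr rfl)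
    · intro h
      exact ((hp ⟨z, mem_of_mem h p.2⟩).1 h).imp (congrArg Subtype.val) (congrArg Subtype.val)
  · exact D.congr (V := V) (P := fun v => v 0 = s (fun i => v (i + 1)) ∨ v 0 = t (fun i => v (i + 1)))
      inferInstance fun _ _ => by rw [ZFSet.mem_pair]

instance DT.singleton {s : (ℕ → ZFSet.{u}) → ZFSet.{u}} [hs : DT V s] :
    DT V (fun v => ({s v} : ZFSet.{u})) :=
  DT.congr (V := V) (s := fun v => ({s v, s v} : ZFSet.{u})) inferInstance fun _ _ => by simp

instance DT.pair {s t : (ℕ → ZFSet.{u}) → ZFSet.{u}} [hs : DT V s] [ht : DT V t] :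
    DT V (fun v => ZFSet.pair (s v) (t v)) :=
  DT.congr (V := V) (s := fun v => ({{s v}, {s v, t v}} : ZFSet.{u})) inferInstance fun _ _ => rfl

instance DT.sUnion {s : (ℕ → ZFSet.{u}) → ZFSet.{u}} [hs : DT V s] :
    DT V (fun v => (ZFSet.sUnion (s v))) := by
  refine DT.of_mem (fun v hv => ?_) ?_
  · obtain ⟨p, hp⟩ := hV.out.models.union ⟨_, hs.mem v hv⟩
    convert p.2
    ext z
    rw [ZFSet.mem_sUnion]
    constructor
    · rintro ⟨y, hy, hz⟩
      have := mem_of_mem hy (hs.mem v hv)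
      exact (hp ⟨_, mem_of_mem hz this⟩).2 ⟨⟨_, this⟩, hy, hz⟩
    · intro h
      obtain ⟨y, h1, h2⟩ := (hp ⟨z, mem_of_mem h p.2⟩).1 h
      exact ⟨y, h1, h2⟩
  · have h : D V (fun v => ∃ y ∈ s (fun i => v (i + 1)), v 0 ∈ y) := inferInstance
    exact h.congr fun _ _ => by rw [ZFSet.mem_sUnion]

instance DT.union {s t : (ℕ → ZFSet.{u}) → ZFSet.{u}} [hs : DT V s] [ht : DT V t] :
    DT V (fun v => s v ∪ t v) :=
  DT.congr (V := V) (s := fun v => ZFSet.sUnion {s v, t v}) inferInstance fun _ _ => by simp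

instance DT.insert {s t : (ℕ → ZFSet.{u}) → ZFSet.{u}} [hs : DT V s] [ht : DT V t] :
    DT V (fun v => insert (s v) (t v)) :=
  DT.congr (V := V) (s := fun v => {s v} ∪ t v) inferInstance fun _ _ => (ZFSet.insert_eq _ _).symm

instance DT.inter {s t : (ℕ → ZFSet.{u}) → ZFSet.{u}} [hs : DT V s] [ht : DT V t] :
    DT V (fun v => s v ∩ t v) :=
  DT.congr (V := V) (s := fun v => ZFSet.sep (fun x => x ∈ t v) (s v)) inferInstance fun _ _ => rfl

instance DT.sdiff {s t : (ℕ → ZFSet.{u}) → ZFSet.{u}} [hs : DT V s] [ht : DT V t] :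
    DT V (fun v => s v \ t v) :=
  DT.congr (V := V) (s := fun v => ZFSet.sep (fun x => x ∉ t v) (s v)) inferInstance fun _ _ => rfl

instance DT.powersetIn {s : (ℕ → ZFSet.{u}) → ZFSet.{u}} [hs : DT V s] :
    DT V (fun v => powersetIn V (s v)) := by
  refine DT.of_mem (fun v hv => ?_) ?_
  · obtain ⟨p, hp⟩ := hV.out.models.powerset ⟨_, hs.mem v hv⟩
    convert p.2
    ext z
    rw [InnerModels.powersetIn, ZFSet.mem_sep, ZFSet.mem_powerset]
    constructor
    · rintro ⟨h1, h2⟩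
      exact (hp ⟨_, h2⟩).2 fun w hw => h1 hw
    · intro h
      have hz := mem_of_mem h p.2
      exact ⟨fun w hw => (hp ⟨z, hz⟩).1 h ⟨w, mem_of_mem hw hz⟩ hw, hz⟩
  · have h : D V (fun v => v 0 ⊆ s (fun i => v (i + 1))) := inferInstance
    exact h.congr fun v hv => by
        rw [InnerModels.powersetIn, ZFSet.mem_sep, ZFSet.mem_powerset]
        exact (and_iff_left (hv 0)).symm

instance DT.prod {s t : (ℕ → ZFSet.{u}) → ZFSet.{u}} [hs : DT V s] [ht : DT V t] :
    DT V (fun v => ZFSet.prod (s v) (t v)) :=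
  DT.congr (V := V) (s := fun v => ZFSet.sUnion (InnerModels.img (fun x =>
    InnerModels.img (fun y => ZFSet.pair x y) (t v)) (s v))) inferInstance fun _ _ => by
    ext z
    simp only [ZFSet.mem_sUnion, mem_img, ZFSet.mem_prod]
    constructor
    · rintro ⟨_, ⟨x, hx, rfl⟩, h⟩
      obtain ⟨y, hy, rfl⟩ := mem_img.1 h
      exact ⟨x, hx, y, hy, rfl⟩
    · rintro ⟨x, hx, y, hy, rfl⟩
      exact ⟨_, ⟨x, hx, rfl⟩, mem_img.2 ⟨y, hy, rfl⟩⟩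

/-- The value of the function (a set of pairs) `f` at `x`. -/
noncomputable def app (f x : ZFSet.{u}) : ZFSet.{u} :=
  ZFSet.sUnion (ZFSet.sep (fun y => ZFSet.pair x y ∈ f) (ZFSet.sUnion (ZFSet.sUnion f)))

instance DT.app {s t : (ℕ → ZFSet.{u}) → ZFSet.{u}} [hs : DT V s] [ht : DT V t] :
    DT V (fun v => app (s v) (t v)) := by
  unfold InnerModels.app; infer_instance

theorem app_eq {f x y : ZFSet.{u}} (h : ZFSet.pair x y ∈ f)
    (hu : ∀ z, ZFSet.pair x z ∈ f → z = y) : app f x = y := by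
  have : ZFSet.sep (fun y => ZFSet.pair x y ∈ f) (ZFSet.sUnion (ZFSet.sUnion f)) = {y} := by
    ext z
    rw [ZFSet.mem_sep, ZFSet.mem_singleton]
    constructor
    · exact fun hz => hu z hz.2
    · rintro rfl
      refine ⟨ZFSet.mem_sUnion.2 ⟨{x, z}, ZFSet.mem_sUnion.2 ⟨_, h, ?_⟩, ?_⟩, h⟩ <;>
        simp [ZFSet.pair]
  rw [app, this, ZFSet.sUnion_singleton]

/-- The function with domain `a` that maps `x` to `F x`. -/
noncomputable def lam (a : ZFSet.{u}) (F : ZFSet.{u} → ZFSet.{u}) : ZFSet.{u} :=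
  img (fun x => ZFSet.pair x (F x)) a

instance DT.lam {a : (ℕ → ZFSet.{u}) → ZFSet.{u}} [ha : DT V a]
    {F : ZFSet.{u} → (ℕ → ZFSet.{u}) → ZFSet.{u}}
    [hF : DT V (fun v => F (v 0) (fun i => v (i + 1)))] :
    DT V (fun v => lam (a v) (fun z => F z v)) := by
  unfold InnerModels.lam; infer_instance

@[simp]
theorem pair_mem_lam {a x y : ZFSet.{u}} {F : ZFSet.{u} → ZFSet.{u}} :
    ZFSet.pair x y ∈ lam a F ↔ x ∈ a ∧ F x = y := by
  rw [lam, mem_img]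
  constructor
  · rintro ⟨z, hz, h⟩
    obtain ⟨rfl, rfl⟩ := ZFSet.pair_inj.1 h
    exact ⟨hz, rfl⟩
  · rintro ⟨hx, rfl⟩
    exact ⟨x, hx, rfl⟩

theorem app_lam {a x : ZFSet.{u}} {F : ZFSet.{u} → ZFSet.{u}} (hx : x ∈ a) :
    app (lam a F) x = F x :=
  app_eq (pair_mem_lam.2 ⟨hx, rfl⟩) fun _ hz => (pair_mem_lam.1 hz).2.symm

theorem isFunc_lam {a b : ZFSet.{u}} {F : ZFSet.{u} → ZFSet.{u}} (h : ∀ x ∈ a, F x ∈ b) :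
    ZFSet.IsFunc a b (lam a F) := by
  refine ⟨fun z hz => ?_, fun x hx => ⟨F x, pair_mem_lam.2 ⟨hx, rfl⟩, fun y hy =>
    (pair_mem_lam.1 hy).2.symm⟩⟩
  obtain ⟨x, hx, rfl⟩ := mem_img.1 hz
  exact ZFSet.pair_mem_prod.2 ⟨hx, h x hx⟩

theorem _root_.ZFSet.IsFunc.pair_app_mem {a b f x : ZFSet.{u}} (hf : ZFSet.IsFunc a b f)
    (hx : x ∈ a) : ZFSet.pair x (app f x) ∈ f := by
  obtain ⟨y, hy, hu⟩ := hf.2 x hx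
  rwa [app_eq hy hu]

theorem _root_.ZFSet.IsFunc.app_mem {a b f x : ZFSet.{u}} (hf : ZFSet.IsFunc a b f)
    (hx : x ∈ a) : app f x ∈ b :=
  (ZFSet.pair_mem_prod.1 (hf.1 (hf.pair_app_mem hx))).2

theorem _root_.ZFSet.IsFunc.pair_mem_iff {a b f x y : ZFSet.{u}} (hf : ZFSet.IsFunc a b f) :
    ZFSet.pair x y ∈ f ↔ x ∈ a ∧ app f x = y := by
  constructor
  · intro h
    have hx := (ZFSet.pair_mem_prod.1 (hf.1 h)).1
    exact ⟨hx, (hf.2 x hx).unique (hf.pair_app_mem hx) h⟩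
  · rintro ⟨hx, rfl⟩
    exact hf.pair_app_mem hx

theorem _root_.ZFSet.IsFunc.ext {a b b' f g : ZFSet.{u}} (hf : ZFSet.IsFunc a b f)
    (hg : ZFSet.IsFunc a b' g) (h : ∀ x ∈ a, app f x = app g x) : f = g := by
  ext z
  constructor
  · intro hz
    obtain ⟨x, hx, y, -, rfl⟩ := ZFSet.mem_prod.1 (hf.1 hz)
    rw [hg.pair_mem_iff, ← h x hx]
    exact hf.pair_mem_iff.1 hz
  · intro hz
    obtain ⟨x, hx, y, -, rfl⟩ := ZFSet.mem_prod.1 (hg.1 hz)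
    rw [hf.pair_mem_iff, h x hx]
    exact hg.pair_mem_iff.1 hz

instance D.isFunc {r s t : (ℕ → ZFSet.{u}) → ZFSet.{u}} [hr : DT V r] [hs : DT V s]
    [ht : DT V t] : D V (fun v => ZFSet.IsFunc (r v) (s v) (t v)) := by
  -- Bounding the quantifiers over values by the codomain keeps them inside `V`.
  refine D.congr (V := V) (P := fun v => t v ⊆ ZFSet.prod (r v) (s v) ∧ ∀ x ∈ r v, ∃ y ∈ s v,
    ZFSet.pair x y ∈ t v ∧ ∀ z ∈ s v, ZFSet.pair x z ∈ t v → z = y) inferInstance fun _ _ => ?_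
  refine and_congr_right fun h => forall₂_congr fun x hx => ?_
  constructor
  · rintro ⟨y, -, h1, h2⟩
    exact ⟨y, h1, fun z hz => h2 z (ZFSet.pair_mem_prod.1 (h hz)).2 hz⟩
  · rintro ⟨y, h1, h2⟩
    exact ⟨y, (ZFSet.pair_mem_prod.1 (h h1)).2, h1, fun z _ hz => h2 z hz⟩

instance D.isUnboundedIn {s t : (ℕ → ZFSet.{u}) → ZFSet.{u}} [hs : DT V s] [ht : DT V t] :
    D V (fun v => IsUnboundedIn (s v) (t v)) := by
  unfold IsUnboundedIn; infer_instance

instance D.isClub {s t : (ℕ → ZFSet.{u}) → ZFSet.{u}} [hs : DT V s] [ht : DT V t] :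
    D V (fun v => IsClub (s v) (t v)) := by
  unfold IsClub; infer_instance

instance D.isOrdinal {s : (ℕ → ZFSet.{u}) → ZFSet.{u}} [hs : DT V s] :
    D V (fun v => (s v).IsOrdinal) :=
  D.congr (V := V) (P := fun v => (∀ y ∈ s v, y ⊆ s v) ∧ ∀ y ∈ s v, ∀ z ∈ y, z ⊆ y) inferInstance
    fun _ _ => (ZFSet.isOrdinal_iff_forall_mem_isTransitive).symm

end InnerModels

/-! ### Choice, cardinality, iteration and suprema in a model. -/

namespace InnerModels
open Set FirstOrder

variable {V : Set ZFSet.{u}}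

theorem D.comp₂ {R : ZFSet.{u} → ZFSet.{u} → Prop} (hR : D V (fun v => R (v 0) (v 1)))
    {s t : (ℕ → ZFSet.{u}) → ZFSet.{u}} (hs : DT V s) (ht : DT V t) :
    D V (fun v => R (s v) (t v)) :=
  D.bind hs (P := fun x v => R x (t v)) <| D.bind (ht.reindex (· + 1))
    (P := fun y v => R (v 0) y) <| hR.reindex fun i => Nat.casesOn i 1 fun _ => 0

theorem D.comp₁ {R : ZFSet.{u} → Prop} (hR : D V (fun v => R (v 0)))
    {s : (ℕ → ZFSet.{u}) → ZFSet.{u}} (hs : DT V s) : D V (fun v => R (s v)) :=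
  D.bind hs (P := fun x _ => R x) hR

theorem DT.comp₁ {F : ZFSet.{u} → ZFSet.{u}} (hF : DT V (fun v => F (v 0)))
    {s : (ℕ → ZFSet.{u}) → ZFSet.{u}} (hs : DT V s) : DT V (fun v => F (s v)) :=
  ⟨fun v hv => hF.mem (fun _ => s v) fun _ => hs.mem v hv,
    D.comp₂ (R := fun x y => x = F y) hF.graph (DT.var 0) (hs.reindex (· + 1))⟩

theorem CardLE.exists_app {A B : ZFSet.{u}} (h : CardLE V A B) :
    ∃ f ∈ V, (∀ x ∈ A, app f x ∈ B) ∧ ∀ x ∈ A, ∀ y ∈ A, app f x = app f y → x = y := by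
  obtain ⟨f, hf, h1, h2⟩ := h
  exact ⟨f, hf, fun x hx => h1.app_mem hx, fun x hx y hy e =>
    h2 _ _ _ (h1.pair_app_mem hx) (e ▸ h1.pair_app_mem hy)⟩

variable [hV : Fact (IsTransitiveModel V)]

/-- The axiom of choice in `V`, in the form of uniformization. -/
theorem exists_choice {A B : ZFSet.{u}} (hA : A ∈ V) (hB : B ∈ V)
    {R : ZFSet.{u} → ZFSet.{u} → Prop} (hR : D V (fun v => R (v 0) (v 1)))
    (h : ∀ x ∈ A, ∃ y ∈ B, R x y) : ∃ f ∈ V, ∀ x ∈ A, app f x ∈ B ∧ R x (app f x) := by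
  have := Fact.mk hA
  have := Fact.mk hB
  have hR' : ∀ (s t) [hs : DT V s] [ht : DT V t], D V (fun v => R (s v) (t v)) :=
    fun s t hs ht => hR.comp₂ hs ht
  -- Tagging the candidates `b` with `a` makes the family disjoint, as the axiom of choice requires.
  let S : ZFSet.{u} → ZFSet.{u} := fun a => img (fun b => ZFSet.pair a b) (ZFSet.sep (R a) B)
  have hx : img S A ∈ V := mem_model _
  have hS : ∀ a z, z ∈ S a ↔ ∃ b ∈ B, R a b ∧ ZFSet.pair a b = z := by
    intro a z
    simp [S, and_assoc]
  have hne : ∀ y : V, y.1 ∈ img S A → ∃ z : V, z.1 ∈ y.1 := by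
    rintro ⟨y, hy⟩ hyx
    obtain ⟨a, ha, rfl⟩ := mem_img.1 hyx
    obtain ⟨b, hb, hab⟩ := h a ha
    have := (hS a _).2 ⟨b, hb, hab, rfl⟩
    exact ⟨⟨_, mem_of_mem this hy⟩, this⟩
  have hdisj : ∀ y y' : V, y.1 ∈ img S A → y'.1 ∈ img S A → y ≠ y' →
      ∀ z : V, ¬ (z.1 ∈ y.1 ∧ z.1 ∈ y'.1) := by
    rintro ⟨y, hy⟩ ⟨y', hy'⟩ hyx hyx' hne z ⟨h1, h2⟩
    obtain ⟨a, ha, rfl⟩ := mem_img.1 hyx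
    obtain ⟨a', ha', rfl⟩ := mem_img.1 hyx'
    obtain ⟨b, -, -, e⟩ := (hS _ _).1 h1
    obtain ⟨b', -, -, e'⟩ := (hS _ _).1 h2
    rw [← e'] at e
    obtain ⟨rfl, -⟩ := ZFSet.pair_inj.1 e
    exact hne rfl
  obtain ⟨c, hc⟩ := hV.out.models.choice ⟨_, hx⟩ hne hdisj
  have := Fact.mk c.2
  -- The choice set may have elements outside the family; the intersection removes them and leaves a
  -- function graph.
  refine ⟨c.1 ∩ ZFSet.sUnion (img S A), mem_model _, fun a ha => ?_⟩
  have hSa : S a ∈ img S A := mem_img.2 ⟨a, ha, rfl⟩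
  obtain ⟨z, ⟨h1, h2⟩, h3⟩ := hc ⟨S a, mem_of_mem hSa hx⟩ hSa
  obtain ⟨b, hb, hab, e⟩ := (hS _ _).1 h1
  rw [app_eq (y := b)]
  · exact ⟨hb, hab⟩
  · rw [e, ZFSet.mem_inter]
    exact ⟨h2, ZFSet.mem_sUnion.2 ⟨_, hSa, h1⟩⟩
  · intro b' hb'
    obtain ⟨h4, h5⟩ := ZFSet.mem_inter.1 hb'
    obtain ⟨_, h6, h7⟩ := ZFSet.mem_sUnion.1 h5
    obtain ⟨a', ha', rfl⟩ := mem_img.1 h6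
    obtain ⟨b'', hb'', hab'', e'⟩ := (hS _ _).1 h7
    obtain ⟨rfl, rfl⟩ := ZFSet.pair_inj.1 e'
    have := h3 ⟨_, mem_of_mem h4 c.2⟩ ⟨h7, h4⟩
    rw [← this] at e
    exact (ZFSet.pair_inj.1 e).2.symm

/-! ### Cardinality -/

theorem cardLE_of_relation {A B : ZFSet.{u}} (hA : A ∈ V) (hB : B ∈ V)
    {R : ZFSet.{u} → ZFSet.{u} → Prop} (hR : D V (fun v => R (v 0) (v 1)))
    (h : ∀ x ∈ A, ∃ y ∈ B, R x y) (hinj : ∀ x ∈ A, ∀ x' ∈ A, ∀ y, R x y → R x' y → x = x') :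
    CardLE V A B := by
  obtain ⟨f, hf, hfR⟩ := exists_choice hA hB hR h
  have := Fact.mk hA
  have := Fact.mk hf
  refine ⟨lam A (app f), mem_model _, isFunc_lam fun x hx => (hfR x hx).1, fun s t z hs' ht' => ?_⟩
  obtain ⟨hs, rfl⟩ := pair_mem_lam.1 hs'
  obtain ⟨ht, e⟩ := pair_mem_lam.1 ht'
  exact hinj s hs t ht _ (hfR s hs).2 (e ▸ (hfR t ht).2)

theorem cardLE_of_app {A B f : ZFSet.{u}} (hA : A ∈ V) (hf : f ∈ V)
    (h1 : ∀ x ∈ A, app f x ∈ B) (h2 : ∀ x ∈ A, ∀ y ∈ A, app f x = app f y → x = y) :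
    CardLE V A B := by
  have := Fact.mk hA
  have := Fact.mk hf
  refine ⟨lam A (app f), mem_model _, isFunc_lam h1, fun s t z hs' ht' => ?_⟩
  obtain ⟨hs, rfl⟩ := pair_mem_lam.1 hs'
  obtain ⟨ht, e⟩ := pair_mem_lam.1 ht'
  exact h2 s hs t ht e.symm

theorem CardLE.trans {A B C : ZFSet.{u}} (hA : A ∈ V) (h : CardLE V A B) (h' : CardLE V B C) :
    CardLE V A C := by
  obtain ⟨f, hf, h1, h2⟩ := h.exists_app
  obtain ⟨g, hg, h3, h4⟩ := h'.exists_app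
  have := Fact.mk hA
  have := Fact.mk hf
  have := Fact.mk hg
  refine cardLE_of_app (f := lam A fun x => app g (app f x)) hA (mem_model _)
    (fun x hx => ?_) fun x hx y hy => ?_
  · rw [app_lam hx]
    exact h3 _ (h1 _ hx)
  · rw [app_lam hx, app_lam hy]
    exact fun e => h2 x hx y hy (h4 _ (h1 _ hx) _ (h1 _ hy) e)

theorem cardLE_of_subset {A B : ZFSet.{u}} (hA : A ∈ V) (h : A ⊆ B) : CardLE V A B := by
  have := Fact.mk hA
  refine cardLE_of_app (f := lam A fun x => x) hA (mem_model _) (fun x hx => ?_)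
    fun x hx y hy => ?_
  · rw [app_lam hx]
    exact h hx
  · rw [app_lam hx, app_lam hy]
    exact id

theorem cardLE_img {A : ZFSet.{u}} (hA : A ∈ V) {F : ZFSet.{u} → ZFSet.{u}}
    (hF : DT V (fun v => F (v 0))) : CardLE V (img F A) A := by
  have := Fact.mk hA
  have : ∀ (s) [hs : DT V s], DT V (fun v => F (s v)) := fun s hs => hF.comp₁ hs
  refine cardLE_of_relation (R := fun y x => F x = y) (mem_model _) hA inferInstance ?_ ?_
  · intro y hy
    exact mem_img.1 hy
  · rintro _ _ _ _ y rfl rfl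
    rfl

/-! ### Natural numbers -/

/-- The natural number `n` as a set. -/
noncomputable def nat : ℕ → ZFSet.{u}
  | 0 => ∅
  | n + 1 => insert (nat n) (nat n)

theorem mem_omega_iff {x : ZFSet.{u}} : x ∈ ZFSet.omega ↔ ∃ n : ℕ, nat n = x := by
  have key : ∀ n : ℕ, nat n = ZFSet.mk (PSet.ofNat n) := by
    intro n
    induction n with
    | zero => rfl
    | succ n ih => rw [nat, ih]; rfl
  constructor
  · induction x using Quotient.inductionOn with | _ x =>
    rintro ⟨⟨n⟩, h⟩
    exact ⟨n, (key n).trans (ZFSet.sound h).symm⟩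
  · rintro ⟨n, rfl⟩
    induction n with
    | zero => exact ZFSet.omega_zero
    | succ n ih => exact ZFSet.omega_succ ih

theorem nat_mem_omega (n : ℕ) : nat n ∈ ZFSet.omega.{u} := mem_omega_iff.2 ⟨n, rfl⟩

theorem mem_nat {n : ℕ} {x : ZFSet.{u}} : x ∈ nat n ↔ ∃ m < n, nat m = x := by
  induction n with
  | zero => simp [nat]
  | succ n ih =>
    rw [nat, ZFSet.mem_insert_iff, ih]
    constructor
    · rintro (rfl | ⟨m, hm, rfl⟩)
      · exact ⟨n, by omega, rfl⟩
      · exact ⟨m, by omega, rfl⟩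
    · rintro ⟨m, hm, rfl⟩
      rcases Nat.lt_succ_iff_lt_or_eq.1 hm with h | rfl
      · exact Or.inr ⟨m, h, rfl⟩
      · exact Or.inl rfl

theorem isOrdinal_nat (n : ℕ) : (nat n : ZFSet.{u}).IsOrdinal := by
  induction n with
  | zero => exact ZFSet.isOrdinal_empty
  | succ n ih => exact ZFSet.isOrdinal_succ ih

theorem nat_mem_nat_of_lt {m n : ℕ} (h : m < n) : (nat m : ZFSet.{u}) ∈ nat n :=
  mem_nat.2 ⟨m, h, rfl⟩

theorem nat_injective : Function.Injective nat.{u} := by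
  intro m n h
  rcases lt_trichotomy m n with h' | h' | h'
  · exact absurd (nat_mem_nat_of_lt h') (h ▸ ZFSet.mem_irrefl _)
  · exact h'
  · exact absurd (nat_mem_nat_of_lt h') (h ▸ ZFSet.mem_irrefl _)

theorem isOrdinal_omega : ZFSet.omega.{u}.IsOrdinal := by
  refine ZFSet.isOrdinal_iff_forall_mem_isOrdinal.2 ⟨fun x hx y hy => ?_, fun x hx => ?_⟩
  · obtain ⟨n, rfl⟩ := mem_omega_iff.1 hx
    obtain ⟨m, -, rfl⟩ := mem_nat.1 hy
    exact nat_mem_omega m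
  · obtain ⟨n, rfl⟩ := mem_omega_iff.1 hx
    exact isOrdinal_nat n

/-- Definition by recursion on `ω` in `V`. -/
theorem exists_iterate (hω : ZFSet.omega ∈ V) {A x₀ : ZFSet.{u}} (hA : A ∈ V) (hx₀ : x₀ ∈ A)
    {H : ZFSet.{u} → ZFSet.{u}} (hH : DT V (fun v => H (v 0))) (hHA : ∀ x ∈ A, H x ∈ A) :
    ∃ f ∈ V, ∀ n : ℕ, app f (nat n) = H^[n] x₀ := by
  have := Fact.mk hω
  have := Fact.mk hA
  have := Fact.mk (mem_of_mem hx₀ hA)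
  have : ∀ (s) [hs : DT V s], DT V (fun v => H (s v)) := fun s hs => hH.comp₁ hs
  let Cl : ZFSet.{u} → Prop := fun S => ZFSet.pair ∅ x₀ ∈ S ∧
    ∀ n ∈ ZFSet.omega, ∀ x ∈ A, ZFSet.pair n x ∈ S → ZFSet.pair (insert n n) (H x) ∈ S
  -- The least relation containing `(0, x₀)` and closed under `(n, x) ↦ (n + 1, H x)`; it turns out
  -- to be the graph of the iteration.
  let R : ZFSet.{u} := ZFSet.sep (fun p => ∀ S ∈ V, Cl S → p ∈ S) (ZFSet.prod ZFSet.omega A)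
  have hR : R ∈ V := mem_model _
  have := Fact.mk hR
  have hmemA : ∀ n : ℕ, H^[n] x₀ ∈ A := by
    intro n
    induction n with
    | zero => exact hx₀
    | succ n ih => rw [Function.iterate_succ_apply']; exact hHA _ ih
  have hR1 : ∀ n : ℕ, ZFSet.pair (nat n) (H^[n] x₀) ∈ R := by
    intro n
    refine ZFSet.mem_sep.2 ⟨ZFSet.pair_mem_prod.2 ⟨nat_mem_omega n, hmemA n⟩, fun S _ hS => ?_⟩
    induction n with
    | zero => exact hS.1
    | succ n ih =>
      rw [Function.iterate_succ_apply']
      exact hS.2 _ (nat_mem_omega n) _ (hmemA n) ih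
  have hR2 : ∀ n : ℕ, ∀ y, ZFSet.pair (nat n) y ∈ R → y = H^[n] x₀ := by
    intro n
    induction n with
    | zero =>
      intro y hy
      by_contra hne
      have := Fact.mk (mem_of_mem hy hR)
      -- Removing a wrong value from `R` would leave a closed relation, against minimality.
      have hS := (ZFSet.mem_sep.1 hy).2 (R \ {ZFSet.pair (nat 0) y}) (mem_model _) ?_
      · simp at hS
      · refine ⟨?_, fun n hn x hx h => ?_⟩
        · rw [ZFSet.mem_sdiff, ZFSet.mem_singleton]
          exact ⟨hR1 0, fun e => hne (ZFSet.pair_inj.1 e).2.symm⟩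
        · rw [ZFSet.mem_sdiff, ZFSet.mem_singleton] at h ⊢
          refine ⟨ZFSet.mem_sep.2 ⟨ZFSet.pair_mem_prod.2 ⟨ZFSet.omega_succ hn, hHA x hx⟩,
            fun S hSV hS => hS.2 n hn x hx ((ZFSet.mem_sep.1 h.1).2 S hSV hS)⟩, fun e => ?_⟩
          have := (ZFSet.pair_inj.1 e).1
          exact ZFSet.notMem_empty n (this.subset (ZFSet.mem_insert n n))
    | succ k ih =>
      intro y hy
      by_contra hne
      have := Fact.mk (mem_of_mem hy hR)
      have hS := (ZFSet.mem_sep.1 hy).2 (R \ {ZFSet.pair (nat (k + 1)) y}) (mem_model _) ?_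
      · simp at hS
      · refine ⟨?_, fun n hn x hx h => ?_⟩
        · rw [ZFSet.mem_sdiff, ZFSet.mem_singleton]
          refine ⟨hR1 0, fun e => ?_⟩
          have := (ZFSet.pair_inj.1 e).1
          exact ZFSet.notMem_empty (nat k) (this.symm.subset (ZFSet.mem_insert (nat k) (nat k)))
        · rw [ZFSet.mem_sdiff, ZFSet.mem_singleton] at h ⊢
          refine ⟨ZFSet.mem_sep.2 ⟨ZFSet.pair_mem_prod.2 ⟨ZFSet.omega_succ hn, hHA x hx⟩,
            fun S hSV hS => hS.2 n hn x hx ((ZFSet.mem_sep.1 h.1).2 S hSV hS)⟩, fun e => ?_⟩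
          obtain ⟨e1, rfl⟩ := ZFSet.pair_inj.1 e
          obtain ⟨m, rfl⟩ := mem_omega_iff.1 hn
          have e2 : m + 1 = k + 1 := nat_injective e1
          obtain rfl : m = k := by omega
          rw [ih x h.1, Function.iterate_succ_apply'] at hne
          exact hne rfl
  exact ⟨R, hR, fun n => app_eq (hR1 n) (hR2 n)⟩

/-! ### Suprema and cofinality -/

/-- The supremum of the successors of the ordinals `F j`, `j ∈ η`. -/
noncomputable def ssup (η : ZFSet.{u}) (F : ZFSet.{u} → ZFSet.{u}) : ZFSet.{u} :=
  ZFSet.sUnion (img (fun j => insert (F j) (F j)) η)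

instance DT.ssup {a : (ℕ → ZFSet.{u}) → ZFSet.{u}} [ha : DT V a]
    {F : ZFSet.{u} → (ℕ → ZFSet.{u}) → ZFSet.{u}}
    [hF : DT V (fun v => F (v 0) (fun i => v (i + 1)))] :
    DT V (fun v => ssup (a v) (fun z => F z v)) := by
  unfold InnerModels.ssup; infer_instance

theorem mem_ssup {η x : ZFSet.{u}} {F : ZFSet.{u} → ZFSet.{u}} :
    x ∈ ssup η F ↔ ∃ j ∈ η, x = F j ∨ x ∈ F j := by
  simp [ssup]

theorem app_mem_ssup {η j : ZFSet.{u}} {F : ZFSet.{u} → ZFSet.{u}} (hj : j ∈ η) :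
    F j ∈ ssup η F := mem_ssup.2 ⟨j, hj, Or.inl rfl⟩

theorem isOrdinal_ssup {η : ZFSet.{u}} {F : ZFSet.{u} → ZFSet.{u}}
    (h : ∀ j ∈ η, (F j).IsOrdinal) : (ssup η F).IsOrdinal := by
  refine ZFSet.isOrdinal_iff_forall_mem_isOrdinal.2 ⟨fun x hx y hy => ?_, fun x hx => ?_⟩
  · obtain ⟨j, hj, rfl | hx⟩ := mem_ssup.1 hx
    · exact mem_ssup.2 ⟨j, hj, Or.inr hy⟩
    · exact mem_ssup.2 ⟨j, hj, Or.inr ((h j hj).mem_trans hy hx)⟩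
  · obtain ⟨j, hj, rfl | hx⟩ := mem_ssup.1 hx
    · exact h j hj
    · exact (h j hj).mem hx

/-- Otherwise `F` restricted to `η` would itself be a cofinal map in `V`. -/
theorem ssup_mem {κ η : ZFSet.{u}} (hκ : κ.IsOrdinal) (hη : η ∈ V)
    (hno : ¬ HasCofinalMap V κ η) {F : ZFSet.{u} → ZFSet.{u}} (hF : DT V (fun v => F (v 0)))
    (hmap : ∀ j ∈ η, F j ∈ κ) : ssup η F ∈ κ := by
  have := Fact.mk hη
  have : ∀ (s) [hs : DT V s], DT V (fun v => F (s v)) := fun s hs => hF.comp₁ hs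
  by_contra hcon
  refine hno ⟨lam η F, mem_model _, isFunc_lam hmap, fun α hα => ?_⟩
  by_contra! h
  have hord : ∀ j ∈ η, (F j).IsOrdinal := fun j hj => hκ.mem (hmap j hj)
  refine hcon ((isOrdinal_ssup hord).mem_of_subset_of_mem hκ (y := α) (fun x hx => ?_) hα)
  obtain ⟨j, hj, hx⟩ := mem_ssup.1 hx
  have hjα := ((hκ.mem hα).not_subset_iff_mem (hord j hj)).1
    (h j (F j) (pair_mem_lam.2 ⟨hj, rfl⟩))
  rcases hx with rfl | hx
  · exact hjα
  · exact (hκ.mem hα).mem_trans hx hjα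

end InnerModels

/-! ### Cofinal sequences, diagonal intersections and pseudo-intersections of clubs. -/

namespace InnerModels
open Set FirstOrder

variable {V : Set ZFSet.{u}}

theorem succ_subset {x y : ZFSet.{u}} (hy : y.IsOrdinal) (h : x ∈ y) : insert x x ⊆ y := by
  intro z hz
  rcases ZFSet.mem_insert_iff.1 hz with rfl | hz
  · exact h
  · exact hy.mem_trans hz h

theorem union_mem_of_isOrdinal {κ x y : ZFSet.{u}} (hκ : κ.IsOrdinal) (hx : x ∈ κ) (hy : y ∈ κ) :
    x ∪ y ∈ κ := by
  rcases (hκ.mem hx).subset_total (hκ.mem hy) with h | h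
  · convert hy
    ext z
    rw [ZFSet.mem_union]
    exact ⟨fun hz => hz.elim (@h z) id, Or.inr⟩
  · convert hx
    ext z
    rw [ZFSet.mem_union]
    exact ⟨fun hz => hz.elim id (@h z), Or.inl⟩

theorem isOrdinal_sUnion_img {η : ZFSet.{u}} {F : ZFSet.{u} → ZFSet.{u}}
    (h : ∀ j ∈ η, (F j).IsOrdinal) : (ZFSet.sUnion (img F η)).IsOrdinal := by
  refine ZFSet.isOrdinal_iff_forall_mem_isOrdinal.2 ⟨fun x hx y hy => ?_, fun x hx => ?_⟩
  · obtain ⟨_, h1, hx⟩ := ZFSet.mem_sUnion.1 hx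
    obtain ⟨j, hj, rfl⟩ := mem_img.1 h1
    exact ZFSet.mem_sUnion.2 ⟨_, h1, (h j hj).mem_trans hy hx⟩
  · obtain ⟨_, h1, hx⟩ := ZFSet.mem_sUnion.1 hx
    obtain ⟨j, hj, rfl⟩ := mem_img.1 h1
    exact (h j hj).mem hx

theorem isClub_self {κ : ZFSet.{u}} (h : ∀ x ∈ κ, insert x x ∈ κ) : IsClub κ κ :=
  ⟨⟨fun _ hx => hx, fun α hα => ⟨_, h α hα, ZFSet.mem_insert _ _⟩⟩, fun _ hδ _ _ => hδ⟩

/-- `A` is a definable monotone cofinal map from `θ` to `κ`, where `θ` is the cofinality of `κ`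
in `V`. -/
structure IsCofSeq (V : Set ZFSet.{u}) (κ θ : ZFSet.{u}) (A : ZFSet.{u} → ZFSet.{u}) : Prop where
  mem_κ : κ ∈ V
  mem_θ : θ ∈ V
  ord_κ : κ.IsOrdinal
  ord_θ : θ.IsOrdinal
  no_map : ∀ η ∈ θ, ¬ HasCofinalMap V κ η
  definable : DT V (fun v => A (v 0))
  maps : ∀ i ∈ θ, A i ∈ κ
  mono : ∀ i ∈ θ, ∀ j ∈ θ, i ⊆ j → A i ⊆ A j
  cofinal : ∀ a ∈ κ, ∃ i ∈ θ, a ∈ A i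

/-- The supremum of the first `δ` values of `A`. -/
noncomputable def gsup (A : ZFSet.{u} → ZFSet.{u}) (δ : ZFSet.{u}) : ZFSet.{u} :=
  ZFSet.sUnion (img A δ)

theorem mem_gsup {A : ZFSet.{u} → ZFSet.{u}} {δ x : ZFSet.{u}} :
    x ∈ gsup A δ ↔ ∃ i ∈ δ, x ∈ A i := by
  simp [gsup]

variable [hV : Fact (IsTransitiveModel V)]

namespace IsCofSeq

variable {κ θ : ZFSet.{u}} {A : ZFSet.{u} → ZFSet.{u}} (h : IsCofSeq V κ θ A)

include h

/-- Regularity of a cofinality: `A ∘ F` is bounded in `κ`, say by `A k`, and monotonicity of `A`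
then bounds `F` by `k`. -/
theorem ssup_mem_θ {η : ZFSet.{u}} (hη : η ∈ θ) {F : ZFSet.{u} → ZFSet.{u}}
    (hF : DT V (fun v => F (v 0))) (hmap : ∀ j ∈ η, F j ∈ θ) : ssup η F ∈ θ := by
  have hs : ssup η (fun j => A (F j)) ∈ κ :=
    ssup_mem h.ord_κ (mem_of_mem hη h.mem_θ) (h.no_map η hη) (h.definable.comp₁ hF)
      fun j hj => h.maps _ (hmap j hj)
  obtain ⟨k, hk, hsk⟩ := h.cofinal _ hs
  have hord : ∀ j ∈ η, (F j).IsOrdinal := fun j hj => h.ord_θ.mem (hmap j hj)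
  refine (isOrdinal_ssup hord).mem_of_subset_of_mem h.ord_θ (y := k) (fun x hx => ?_) hk
  obtain ⟨j, hj, hx⟩ := mem_ssup.1 hx
  have hjk : F j ∈ k := by
    refine ((h.ord_θ.mem hk).not_subset_iff_mem (hord j hj)).1 fun hsub => ?_
    have h1 := h.mono _ hk _ (hmap j hj) hsub
    have h2 : A (F j) ∈ A k := (h.ord_κ.mem (h.maps k hk)).mem_trans
      (app_mem_ssup (F := fun j => A (F j)) hj) hsk
    exact ZFSet.mem_irrefl _ (h1 h2)
  rcases hx with rfl | hx
  · exact hjk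
  · exact (h.ord_θ.mem hk).mem_trans hx hjk

theorem gsup_mem {δ : ZFSet.{u}} (hδ : δ ∈ θ) : gsup A δ ∈ κ := by
  have hm : ∀ j ∈ δ, A j ∈ κ := fun j hj => h.maps _ (h.ord_θ.mem_trans hj hδ)
  refine (isOrdinal_sUnion_img fun j hj => h.ord_κ.mem (hm j hj)).mem_of_subset_of_mem h.ord_κ
    (y := ssup δ A) (fun x hx => ?_) (ssup_mem h.ord_κ (mem_of_mem hδ h.mem_θ) (h.no_map δ hδ)
      h.definable hm)
  obtain ⟨i, hi, hx⟩ := mem_gsup.1 hx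
  exact mem_ssup.2 ⟨i, hi, Or.inr hx⟩

theorem succ_mem (hω : ZFSet.omega ∈ θ) {i : ZFSet.{u}} (hi : i ∈ θ) : insert i i ∈ θ := by
  have := Fact.mk (mem_of_mem hi h.mem_θ)
  -- The successor of `i` is the strict supremum of a one-term family.
  have h1 := h.ssup_mem_θ (F := fun _ => i) (h.ord_θ.mem_trans (nat_mem_omega 1) hω)
    inferInstance fun _ _ => hi
  convert h1
  ext z
  rw [mem_ssup, ZFSet.mem_insert_iff]
  exact ⟨fun hz => ⟨_, nat_mem_nat_of_lt one_pos, hz⟩, fun ⟨_, _, hz⟩ => hz⟩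

/-- Closing off `ω` times stays below `θ` because `θ` is regular and greater than `ω`. -/
theorem exists_closed (hω : ZFSet.omega ∈ θ) {H : ZFSet.{u} → ZFSet.{u}}
    (hH : DT V (fun v => H (v 0))) (hmap : ∀ i ∈ θ, H i ∈ θ) {i : ZFSet.{u}} (hi : i ∈ θ) :
    ∃ δ ∈ θ, i ∈ δ ∧ ∀ j ∈ δ, H j ∈ δ := by
  have : ∀ (s) [hs : DT V s], DT V (fun v => H (s v)) := fun s hs => hH.comp₁ hs
  have hG : ∀ x ∈ θ, ssup (insert x x) H ∈ θ := fun x hx =>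
    h.ssup_mem_θ (h.succ_mem hω hx) hH fun j hj =>
      hmap j (succ_subset h.ord_θ hx hj)
  obtain ⟨f, hf, hfn⟩ := exists_iterate (mem_of_mem hω h.mem_θ) h.mem_θ hi
    (H := fun x => ssup (insert x x) H) inferInstance hG
  have := Fact.mk hf
  have hfθ : ∀ n : ℕ, app f (nat n) ∈ θ := by
    intro n
    rw [hfn]
    induction n with
    | zero => exact hi
    | succ n ih => rw [Function.iterate_succ_apply']; exact hG _ ih
  refine ⟨ssup ZFSet.omega (app f), h.ssup_mem_θ hω inferInstance ?_, ?_, ?_⟩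
  · intro j hj
    obtain ⟨n, rfl⟩ := mem_omega_iff.1 hj
    exact hfθ n
  · exact mem_ssup.2 ⟨nat 0, nat_mem_omega 0, Or.inl (hfn 0).symm⟩
  · intro j hj
    obtain ⟨_, hn, hj⟩ := mem_ssup.1 hj
    obtain ⟨n, rfl⟩ := mem_omega_iff.1 hn
    refine mem_ssup.2 ⟨nat (n + 1), nat_mem_omega _, Or.inr ?_⟩
    rw [hfn (n + 1), Function.iterate_succ_apply', ← hfn n]
    exact app_mem_ssup (ZFSet.mem_insert_iff.2 hj)

/-- The diagonal intersection of the clubs `E i`, `i < θ`, contains the image of a club of `θ`. -/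
theorem exists_diagonal_club (hω : ZFSet.omega ∈ θ) {E : ZFSet.{u} → ZFSet.{u}}
    (hE : DT V (fun v => E (v 0))) (hclub : ∀ i ∈ θ, IsClub (E i) κ) :
    ∃ D ∈ V, IsClub D θ ∧ ∀ δ ∈ D, ∀ i ∈ δ, gsup A δ ∈ E i ∧ ∃ k ∈ δ, i ∈ k := by
  have := Fact.mk h.mem_κ
  have := Fact.mk h.mem_θ
  have hE' : ∀ (s) [hs : DT V s], DT V (fun v => E (s v)) := fun s hs => hE.comp₁ hs
  have hA' : ∀ (s) [hs : DT V s], DT V (fun v => A (s v)) := fun s hs => h.definable.comp₁ hs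
  -- The `x` with no point of `E j` between `A i` and `A x` form an initial segment of `θ`; as an
  -- ordinal, it is the least index for which there is such a point.
  let K : ZFSet.{u} → ZFSet.{u} → ZFSet.{u} := fun i j =>
    ZFSet.sep (fun x => ¬ ∃ e ∈ E j, A i ∈ e ∧ e ∈ A x) θ
  have hKθ : ∀ i ∈ θ, ∀ j ∈ θ, K i j ∈ θ := by
    intro i hi j hj
    obtain ⟨e, he, hie⟩ := (hclub j hj).1.2 (A i) (h.maps i hi)
    obtain ⟨k, hk, hek⟩ := h.cofinal e ((hclub j hj).1.1 he)
    have hord : (K i j).IsOrdinal := by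
      refine ZFSet.isOrdinal_iff_forall_mem_isOrdinal.2 ⟨fun x hx y hy => ?_, fun x hx =>
        h.ord_θ.mem (ZFSet.mem_sep.1 hx).1⟩
      obtain ⟨hx1, hx2⟩ := ZFSet.mem_sep.1 hx
      have hy1 := h.ord_θ.mem_trans hy hx1
      exact ZFSet.mem_sep.2 ⟨hy1, fun ⟨e, he, h1, h2⟩ => hx2 ⟨e, he, h1,
        h.mono y hy1 x hx1 ((h.ord_θ.mem hx1).subset_of_mem hy) h2⟩⟩
    refine hord.mem_of_subset_of_mem h.ord_θ (y := k) (fun x hx => ?_) hk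
    obtain ⟨hx1, hx2⟩ := ZFSet.mem_sep.1 hx
    exact ((h.ord_θ.mem hk).not_subset_iff_mem (h.ord_θ.mem hx1)).1 fun hkx =>
      hx2 ⟨e, he, hie, h.mono k hk x hx1 hkx hek⟩
  have hK : ∀ i ∈ θ, ∀ j ∈ θ, ∃ e ∈ E j, A i ∈ e ∧ e ∈ A (K i j) := by
    intro i hi j hj
    by_contra hcon
    exact ZFSet.mem_irrefl _ (ZFSet.mem_sep.2 ⟨hKθ i hi j hj, hcon⟩ : K i j ∈ K i j)
  -- `H i` exceeds `K i j` for all `j ≤ i`. If `δ` is closed under `H`, then `gsup A δ` is a limit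
  -- of each `E j` with `j < δ`.
  let H : ZFSet.{u} → ZFSet.{u} := fun i => ssup (insert i i) (K i)
  have hH : DT V (fun v => H (v 0)) := inferInstance
  have hHθ : ∀ i ∈ θ, H i ∈ θ := by
    intro i hi
    have := Fact.mk (mem_of_mem hi h.mem_θ)
    exact h.ssup_mem_θ (h.succ_mem hω hi) inferInstance fun j hj =>
      hKθ i hi j (succ_subset h.ord_θ hi hj)
  have hH' : ∀ (s) [hs : DT V s], DT V (fun v => H (s v)) := fun s hs => hH.comp₁ hs
  have key : ∀ δ ∈ θ, (∀ i ∈ δ, H i ∈ δ) → ∀ i ∈ δ, ∀ j ∈ δ, j ∈ insert i i →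
      ∃ e ∈ E j, A i ∈ e ∧ ∃ k ∈ δ, e ∈ A k := by
    intro δ hδ hcl i hi j hj hji
    have hi' := h.ord_θ.mem_trans hi hδ
    obtain ⟨e, he, h1, h2⟩ := hK i hi' j (h.ord_θ.mem_trans hj hδ)
    exact ⟨e, he, h1, _, (h.ord_θ.mem hδ).mem_trans (app_mem_ssup hji) (hcl i hi), h2⟩
  refine ⟨ZFSet.sep (fun δ => δ.Nonempty ∧ ∀ i ∈ δ, H i ∈ δ) θ, mem_model _, ⟨⟨?_, ?_⟩, ?_⟩, ?_⟩
  · exact ZFSet.sep_subset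
  · intro i hi
    obtain ⟨δ, hδ, hiδ, hcl⟩ := h.exists_closed hω hH hHθ hi
    exact ⟨δ, ZFSet.mem_sep.2 ⟨hδ, ⟨i, hiδ⟩, hcl⟩, hiδ⟩
  · intro δ hδ hne hlim
    refine ZFSet.mem_sep.2 ⟨hδ, hne, fun i hi => ?_⟩
    obtain ⟨β, hβ, hβδ, hiβ⟩ := hlim i hi
    exact (h.ord_θ.mem hδ).mem_trans ((ZFSet.mem_sep.1 hβ).2.2 i hiβ) hβδ
  · intro δ hδ i hi
    obtain ⟨hδθ, hne, hcl⟩ := ZFSet.mem_sep.1 hδ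
    have hordδ := h.ord_θ.mem hδθ
    have hi' := h.ord_θ.mem_trans hi hδθ
    constructor
    · refine (hclub i hi').2 _ (h.gsup_mem hδθ) ?_ fun a ha => ?_
      · obtain ⟨e, he, h1, k, hk, h2⟩ := key δ hδθ hcl i hi i hi (ZFSet.mem_insert _ _)
        exact ⟨e, mem_gsup.2 ⟨k, hk, h2⟩⟩
      · obtain ⟨i', hi'δ, ha⟩ := mem_gsup.1 ha
        -- `m = max i i'`: it lies above `a` through `i'`, and `H m` takes the club `E i` into
        -- account.
        obtain ⟨m, hm, him, hi'm⟩ : ∃ m ∈ δ, i ∈ insert m m ∧ i' ⊆ m := by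
          rcases (hordδ.mem hi).mem_or_subset (hordδ.mem hi'δ) with h' | h'
          · exact ⟨i', hi'δ, ZFSet.mem_insert_of_mem _ h', subset_rfl⟩
          · exact ⟨i, hi, ZFSet.mem_insert _ _, h'⟩
        obtain ⟨e, he, h1, k, hk, h2⟩ := key δ hδθ hcl m hm i hi him
        have hmθ := h.ord_θ.mem_trans hm hδθ
        refine ⟨e, he, mem_gsup.2 ⟨k, hk, h2⟩, ?_⟩
        exact (h.ord_κ.mem ((hclub i hi').1.1 he)).mem_trans
          (h.mono i' (h.ord_θ.mem_trans hi'δ hδθ) m hmθ hi'm ha) h1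
    · obtain ⟨e, he, h1, k, hk, h2⟩ := key δ hδθ hcl i hi i hi (ZFSet.mem_insert _ _)
      refine ⟨k, hk, ((hordδ.mem hk).not_subset_iff_mem (hordδ.mem hi)).1 fun hki => ?_⟩
      have h3 := h.mono k (h.ord_θ.mem_trans hk hδθ) i hi' hki h2
      exact ZFSet.mem_asymm h1 h3

end IsCofSeq

theorem succ_mem_of_isRegular {κ : ZFSet.{u}} (h : IsRegularUncountableIn V κ) {i : ZFSet.{u}}
    (hi : i ∈ κ) : insert i i ∈ κ := by
  have := Fact.mk (mem_of_mem hi h.1.1)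
  have h1 : nat 1 ∈ κ := h.1.2.1.mem_trans (nat_mem_omega 1) h.2.1
  have h2 := ssup_mem (F := fun _ => i) h.1.2.1 (mem_of_mem h1 h.1.1) (h.2.2.2.2 _ h1)
    inferInstance fun _ _ => hi
  convert h2
  ext z
  rw [mem_ssup, ZFSet.mem_insert_iff]
  exact ⟨fun hz => ⟨_, nat_mem_nat_of_lt one_pos, hz⟩, fun ⟨_, _, hz⟩ => hz⟩

/-- With the identity as cofinal sequence, `exists_diagonal_club` becomes the usual diagonal
intersection on a regular cardinal. -/
theorem IsRegularUncountableIn.isCofSeq {κ : ZFSet.{u}} (h : IsRegularUncountableIn V κ) :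
    IsCofSeq V κ κ (fun x => x) where
  mem_κ := h.1.1
  mem_θ := h.1.1
  ord_κ := h.1.2.1
  ord_θ := h.1.2.1
  no_map := h.2.2.2.2
  definable := inferInstance
  maps _ hi := hi
  mono _ _ _ _ hij := hij
  cofinal _ ha := ⟨_, succ_mem_of_isRegular h ha, ZFSet.mem_insert _ _⟩

/-- A family of at most `κ` clubs of a regular `κ` has a pseudo-intersection that is a club. -/
theorem exists_pseudointersection {κ b : ZFSet.{u}} (h : IsRegularUncountableIn V κ) (hb : b ∈ V)
    (hcard : CardLE V b κ) :
    ∃ F ∈ ClubsOf V κ, ∀ E ∈ b, IsClub E κ → ∃ m ∈ κ, ∀ β ∈ F, β ∉ E → β ∈ m := by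
  obtain ⟨f, hf, h1, h2⟩ := hcard.exists_app
  have := Fact.mk h.1.1
  have := Fact.mk hb
  have := Fact.mk hf
  -- The `i`-th club is the one that the injection `f` sends to `i`. If there is none, the same
  -- formula gives `κ`.
  have hEq : ∀ E ∈ b, IsClub E κ →
      ZFSet.sep (fun x => ∀ E' ∈ b, IsClub E' κ → app f E' = app f E → x ∈ E') κ = E := by
    intro E hE hcl
    ext x
    rw [ZFSet.mem_sep]
    constructor
    · exact fun hx => hx.2 E hE hcl rfl
    · refine fun hx => ⟨hcl.1.1 hx, fun E' hE' _ e => ?_⟩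
      rwa [h2 E' hE' E hE e]
  obtain ⟨D, hD, hDcl, hDE⟩ := h.isCofSeq.exists_diagonal_club h.2.1 (E := fun i =>
    ZFSet.sep (fun x => ∀ E ∈ b, IsClub E κ → app f E = i → x ∈ E) κ) inferInstance fun i _ => by
      by_cases hi : ∃ E ∈ b, IsClub E κ ∧ app f E = i
      · obtain ⟨E, hE, hcl, rfl⟩ := hi
        rwa [hEq E hE hcl]
      · convert isClub_self fun x hx => succ_mem_of_isRegular h hx
        ext x
        rw [ZFSet.mem_sep]
        exact ⟨fun hx => hx.1, fun hx => ⟨hx, fun E hE hcl e => (hi ⟨E, hE, hcl, e⟩).elim⟩⟩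
  refine ⟨D, ⟨hD, hDcl⟩, fun E hE hcl => ⟨_, succ_mem_of_isRegular h (h1 E hE), fun β hβ hβE => ?_⟩⟩
  by_contra hcon
  have hβκ := hDcl.1.1 hβ
  have hordβ := h.1.2.1.mem hβκ
  have hordi := h.1.2.1.mem (h1 E hE)
  have hiβ : app f E ∈ β := by
    refine (hordβ.not_subset_iff_mem hordi).1 fun hsub => hcon ?_
    rcases (hordβ.subset_iff_eq_or_mem hordi).1 hsub with e | hm
    · rw [e]; exact ZFSet.mem_insert _ _
    · exact ZFSet.mem_insert_of_mem _ hm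
  have h3 := (hDE β hβ _ hiβ).1
  rw [hEq E hE hcl] at h3
  refine hβE ?_
  -- Points of `D` are limit ordinals, so the supremum of the elements of `β` is `β`.
  convert h3
  ext x
  rw [mem_gsup]
  constructor
  · intro hx
    obtain ⟨k, hk, hxk⟩ := (hDE β hβ x hx).2
    exact ⟨k, hk, hxk⟩
  · rintro ⟨k, hk, hxk⟩
    exact hordβ.mem_trans hxk hk

/-- Strict suprema of initial segments of a cofinal map are monotone, and they stay below `κ` by
minimality of `θ`. -/
theorem IsCofIn.exists_isCofSeq {κ θ : ZFSet.{u}} (hκ : κ ∈ V) (hord : κ.IsOrdinal)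
    (hlim : ∀ x ∈ κ, insert x x ∈ κ) (hθ : θ ∈ V) (h : IsCofIn V κ θ) :
    ∃ A, IsCofSeq V κ θ A := by
  obtain ⟨hθo, ⟨f, hfV, hf, hcof⟩, hno⟩ := h
  have := Fact.mk hfV
  have hmaps : ∀ i ∈ θ, ∀ j ∈ i, app f j ∈ κ := fun i hi j hj => hf.app_mem (hθo.mem_trans hj hi)
  have hA : ∀ i ∈ θ, ssup i (app f) ∈ κ := fun i hi =>
    ssup_mem hord (mem_of_mem hi hθ) (hno i hi) inferInstance (hmaps i hi)
  have hcof' : ∀ a ∈ κ, ∃ i ∈ θ, a ⊆ app f i := by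
    intro a ha
    obtain ⟨i, y, hiy, hay⟩ := hcof a ha
    obtain ⟨hi, rfl⟩ := hf.pair_mem_iff.1 hiy
    exact ⟨i, hi, hay⟩
  refine ⟨fun i => ssup i (app f), hκ, hθ, hord, hθo, hno, inferInstance, hA, ?_, ?_⟩
  · intro i _ j _ hij x hx
    obtain ⟨k, hk, hx⟩ := mem_ssup.1 hx
    exact mem_ssup.2 ⟨k, hij hk, hx⟩
  · intro a ha
    obtain ⟨i, hi, hai⟩ := hcof' a ha
    refine ⟨insert i i, ?_, mem_ssup.2 ⟨i, ZFSet.mem_insert _ _,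
      ((hord.mem ha).subset_iff_eq_or_mem (hord.mem (hf.app_mem hi))).1 hai⟩⟩
    by_contra hcon
    -- If `i` were the last element of `θ`, no value of `f` would reach the maximum of `A i` and `f
    -- i + 1`.
    have hsub : θ ⊆ insert i i :=
      (ZFSet.isOrdinal_succ (hθo.mem hi)).notMem_iff_subset hθo |>.1 hcon
    obtain ⟨j, hj, hj'⟩ := hcof' _ (union_mem_of_isOrdinal hord (hA i hi)
      (hlim _ (hf.app_mem hi)))
    rcases ZFSet.mem_insert_iff.1 (hsub hj) with rfl | hji
    · exact ZFSet.mem_irrefl _ (hj' (ZFSet.mem_union.2 (Or.inr (ZFSet.mem_insert _ _))))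
    · exact ZFSet.mem_irrefl _ (hj' (ZFSet.mem_union.2 (Or.inl (app_mem_ssup hji))))

end InnerModels

/-! ### Ordinal recursion, well-ordering and the cofinality of the club filter. -/

namespace InnerModels
open Set FirstOrder

variable {V : Set ZFSet.{u}}

/-- The function defined by the recursion `G x = H {G y | y ∈ x}`. -/
noncomputable def memRec (H : ZFSet.{u} → ZFSet.{u}) : ZFSet.{u} → ZFSet.{u} :=
  ZFSet.mem_wf.fix fun x f => H (ZFSet.range fun y : x => f y.1 y.2)

theorem memRec_eq (H : ZFSet.{u} → ZFSet.{u}) (x : ZFSet.{u}) :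
    memRec H x = H (img (memRec H) x) := by
  rw [memRec, WellFounded.fix_eq]
  rfl

theorem img_congr {F G : ZFSet.{u} → ZFSet.{u}} {a : ZFSet.{u}} (h : ∀ x ∈ a, F x = G x) :
    img F a = img G a := by
  ext z
  rw [mem_img, mem_img]
  exact exists_congr fun x => and_congr_right fun hx => by rw [h x hx]

theorem lam_congr {F G : ZFSet.{u} → ZFSet.{u}} {a : ZFSet.{u}} (h : ∀ x ∈ a, F x = G x) :
    lam a F = lam a G :=
  img_congr fun x hx => by rw [h x hx]

/-- Lets the values of `memRec` be defined inside `V` through any approximation `g ∈ V`. -/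
theorem memRec_unique {H : ZFSet.{u} → ZFSet.{u}} {α g : ZFSet.{u}} (hα : α.IsOrdinal)
    (hg : ∀ β ∈ α, app g β = H (img (app g) β)) : ∀ β ∈ α, app g β = memRec H β := by
  intro β
  induction β using ZFSet.inductionOn with | _ β ih =>
  intro hβ
  rw [hg β hβ, memRec_eq, img_congr fun γ hγ => ih γ hγ (hα.mem_trans hγ hβ)]

variable [hV : Fact (IsTransitiveModel V)]

/-- By induction, approximations below each `β ∈ α` lie in `V`. They define the value at `β`, and
replacement collects the values. -/
theorem lam_memRec_mem {H : ZFSet.{u} → ZFSet.{u}} (hH : DT V (fun v => H (v 0)))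
    {α : ZFSet.{u}} (hα : α.IsOrdinal) (hαV : α ∈ V) : lam α (memRec H) ∈ V := by
  induction α using ZFSet.inductionOn with | _ α ih =>
  have hH' : ∀ (s) [hs : DT V s], DT V (fun v => H (s v)) := fun s hs => hH.comp₁ hs
  have := Fact.mk hαV
  have hG : ∀ β ∈ α, memRec H β = H (img (app (lam β (memRec H))) β) := by
    intro β _
    rw [memRec_eq, img_congr fun γ hγ => (app_lam hγ).symm]
  have hg : ∀ β ∈ α, ∀ γ ∈ β, app (lam β (memRec H)) γ =
      H (img (app (lam β (memRec H))) γ) := by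
    intro β hβ γ hγ
    rw [app_lam hγ, memRec_eq, img_congr fun δ hδ =>
      (app_lam ((hα.mem hβ).mem_trans hδ hγ)).symm]
  classical
  -- `DT` asks for a total function into `V`, hence the value `∅` off `α`.
  have hF : DT V (fun v => if v 0 ∈ α then memRec H (v 0) else ∅) := by
    refine ⟨fun v _ => ?_, ?_⟩
    · split_ifs with h
      · have hβ := ih _ h (hα.mem h) (mem_of_mem h hαV)
        have := Fact.mk hβ
        have := Fact.mk (mem_of_mem h hαV)
        rw [hG _ h]
        exact mem_model _
      · exact mem_model _
    · have hD : D V (fun v => (v 1 ∈ α ∧ ∃ g ∈ V, (∀ γ ∈ v 1, app g γ = H (img (app g) γ)) ∧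
          v 0 = H (img (app g) (v 1))) ∨ (¬ v 1 ∈ α ∧ v 0 = ∅)) := inferInstance
      refine hD.congr fun v hv => ?_
      by_cases h : v 1 ∈ α
      · simp only [h, true_and, not_true, false_and, or_false, if_true]
        constructor
        · rintro ⟨g, -, hg, e⟩
          rw [e, memRec_eq, img_congr (memRec_unique (hα.mem h) hg)]
        · intro e
          exact ⟨_, ih _ h (hα.mem h) (hv 1), hg _ h, e.trans (hG _ h)⟩
      · simp [h]
  have hF' : ∀ (s) [hs : DT V s], DT V (fun v => if s v ∈ α then memRec H (s v) else ∅) :=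
    fun s hs =>
    DT.comp₁ (F := fun x => if x ∈ α then memRec H x else ∅) hF hs
  have h1 : lam α (fun x => if x ∈ α then memRec H x else ∅) ∈ V := mem_model _
  rwa [lam_congr (G := memRec H) fun x hx => if_pos hx] at h1

/-- The well-ordering theorem in `V`. -/
theorem exists_ordinal_equiv {P : ZFSet.{u}} (hP : P ∈ V) :
    ∃ α ∈ V, α.IsOrdinal ∧ CardLE V P α ∧ CardLE V α P := by
  have := Fact.mk hP
  obtain ⟨c, hc, hcP⟩ := exists_choice (V := V)
    (A := ZFSet.sep (fun S => S ≠ P) (powersetIn V P)) (B := P)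
    (R := fun S p => ¬ p ∈ S) (mem_model _) hP inferInstance (by
      intro S hS
      obtain ⟨h1, h2⟩ := ZFSet.mem_sep.1 hS
      have h3 := (mem_powersetIn.1 h1).1
      by_contra! h
      exact h2 (by ext z; exact ⟨@h3 z, h z⟩))
  have := Fact.mk hc
  -- `G β` is a chosen element of `P` outside `{G γ | γ < β}`, as long as `P` is not exhausted.
  let G := memRec (app c)
  have hc' : DT V (fun v => app c (v 0)) := inferInstance
  have himg : ∀ β ∈ V, β.IsOrdinal → img G β ∈ V := by
    intro β hβ hord
    have := Fact.mk (lam_memRec_mem hc' hord hβ)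
    have := Fact.mk hβ
    rw [img_congr (G := app (lam β G)) fun γ hγ => (app_lam hγ).symm]
    exact mem_model _
  have hstep : ∀ β ∈ V, β.IsOrdinal → (∀ γ ∈ insert β β, img G γ ≠ P) →
      G β ∈ P ∧ G β ∉ img G β := by
    intro β
    induction β using ZFSet.inductionOn with | _ β ih =>
    intro hβ hord hne
    have hsub : img G β ⊆ P := by
      intro z hz
      obtain ⟨γ, hγ, rfl⟩ := mem_img.1 hz
      refine (ih γ hγ (mem_of_mem hγ hβ) (hord.mem hγ) fun δ hδ => hne δ ?_).1
      exact ZFSet.mem_insert_of_mem _ (succ_subset hord hγ hδ)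
    rw [show G β = app c (img G β) from memRec_eq _ _]
    exact hcP _ (ZFSet.mem_sep.2 ⟨mem_powersetIn.2 ⟨hsub, himg β hβ hord⟩,
      hne β (ZFSet.mem_insert _ _)⟩)
  have hinj : ∀ β γ, β.IsOrdinal → γ.IsOrdinal → G β ∉ img G β → G γ ∉ img G γ →
      G β = G γ → β = γ := by
    intro β γ hβ hγ h1 h2 e
    rcases hβ.mem_trichotomous hγ with h | h | h
    · exact (h2 (mem_img.2 ⟨β, h, e⟩)).elim
    · exact h
    · exact (h1 (mem_img.2 ⟨γ, h, e.symm⟩)).elim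
  have hex : ∃ α ∈ V, α.IsOrdinal ∧ img G α = P := by
    -- Burali-Forti: otherwise `G` injects all ordinals of `V` into `P`, and replacement along its
    -- inverse `J` collects them into a set in `V`.
    by_contra! hcon
    have hstep' : ∀ β ∈ V, β.IsOrdinal → G β ∈ P ∧ G β ∉ img G β := by
      intro β hβ hord
      refine hstep β hβ hord fun γ hγ => ?_
      rcases ZFSet.mem_insert_iff.1 hγ with rfl | hγ
      · exact hcon _ hβ hord
      · exact hcon _ (mem_of_mem hγ hβ) (hord.mem hγ)
    classical
    let J : ZFSet.{u} → ZFSet.{u} := fun p =>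
      if h : ∃ β ∈ V, β.IsOrdinal ∧ p = G β then h.choose else ∅
    have hJ : ∀ β ∈ V, β.IsOrdinal → J (G β) = β := by
      intro β hβ hord
      have h : ∃ β' ∈ V, β'.IsOrdinal ∧ G β = G β' := ⟨β, hβ, hord, rfl⟩
      have h1 := h.choose_spec
      simp only [J, dif_pos h]
      exact hinj _ _ h1.2.1 hord (hstep' _ h1.1 h1.2.1).2 (hstep' _ hβ hord).2 h1.2.2.symm
    have hJD : DT V (fun v => J (v 0)) := by
      refine ⟨fun v _ => ?_, ?_⟩
      · dsimp only [J]
        split_ifs with h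
        · exact h.choose_spec.1
        · exact mem_model _
      -- The graph of `J`, with `v 1 = G β` expressed through approximations in `V`.
      · have hD : D V (fun v => (∃ β ∈ V, β.IsOrdinal ∧ (∃ g ∈ V, (∀ γ ∈ β,
            app g γ = app c (img (app g) γ)) ∧ v 1 = app c (img (app g) β)) ∧ v 0 = β) ∨
            ((¬ ∃ β ∈ V, β.IsOrdinal ∧ ∃ g ∈ V, (∀ γ ∈ β,
            app g γ = app c (img (app g) γ)) ∧ v 1 = app c (img (app g) β)) ∧ v 0 = ∅)) :=
          inferInstance
        refine hD.congr fun v hv => ?_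
        have hGβ : ∀ β ∈ V, β.IsOrdinal → ((∃ g ∈ V, (∀ γ ∈ β,
            app g γ = app c (img (app g) γ)) ∧ v 1 = app c (img (app g) β)) ↔ v 1 = G β) := by
          intro β hβ hord
          constructor
          · rintro ⟨g, -, hg, e⟩
            rw [e, img_congr (memRec_unique hord hg)]
            exact (memRec_eq _ _).symm
          · intro e
            refine ⟨lam β G, lam_memRec_mem hc' hord hβ, fun γ hγ => ?_, ?_⟩
            · rw [app_lam hγ, img_congr (G := G) fun δ hδ => app_lam (hord.mem_trans hδ hγ)]
              exact memRec_eq _ _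
            · rw [e, img_congr (F := app (lam β G)) (G := G) fun δ hδ => app_lam hδ]
              exact memRec_eq _ _
        change _ ↔ v 0 = J (v 1)
        by_cases h : ∃ β ∈ V, β.IsOrdinal ∧ v 1 = G β
        · obtain ⟨β, hβ, hord, e⟩ := h
          rw [e] at hGβ ⊢
          rw [hJ β hβ hord]
          constructor
          · rintro (⟨γ, hγ, hγo, h1, e'⟩ | ⟨h1, -⟩)
            · have h2 := (hGβ γ hγ hγo).1 h1
              rw [e']
              exact hinj _ _ hγo hord (hstep' _ hγ hγo).2 (hstep' _ hβ hord).2 h2.symm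
            · exact (h1 ⟨β, hβ, hord, (hGβ β hβ hord).2 rfl⟩).elim
          · intro e'
            exact Or.inl ⟨β, hβ, hord, (hGβ β hβ hord).2 rfl, e'⟩
        · have h' : ¬ ∃ β ∈ V, β.IsOrdinal ∧ ∃ g ∈ V, (∀ γ ∈ β,
              app g γ = app c (img (app g) γ)) ∧ v 1 = app c (img (app g) β) :=
            fun ⟨β, hβ, hord, h1⟩ => h ⟨β, hβ, hord, (hGβ β hβ hord).1 h1⟩
          simp only [J, dif_neg h]
          constructor
          · rintro (⟨γ, hγ, hγo, h1, e'⟩ | ⟨-, e'⟩)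
            · exact (h' ⟨γ, hγ, hγo, h1⟩).elim
            · exact e'
          · exact fun e' => Or.inr ⟨h', e'⟩
    have hJ' : ∀ (s) [hs : DT V s], DT V (fun v => J (s v)) := fun s hs => hJD.comp₁ hs
    have hO : ZFSet.sep (fun x => x.IsOrdinal) (img J P) ∈ V := mem_model _
    have hmem : ∀ x, x ∈ ZFSet.sep (fun x => x.IsOrdinal) (img J P) ↔ x ∈ V ∧ x.IsOrdinal := by
      intro x
      constructor
      · exact fun hx => ⟨mem_of_mem hx hO, (ZFSet.mem_sep.1 hx).2⟩
      · rintro ⟨hx, hord⟩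
        exact ZFSet.mem_sep.2 ⟨mem_img.2 ⟨G x, (hstep' x hx hord).1, hJ x hx hord⟩, hord⟩
    refine ZFSet.mem_irrefl _ ((hmem _).2 ⟨hO, ?_⟩)
    refine ZFSet.isOrdinal_iff_forall_mem_isOrdinal.2 ⟨fun x hx y hy => ?_, fun x hx =>
      ((hmem x).1 hx).2⟩
    obtain ⟨h1, h2⟩ := (hmem x).1 hx
    exact (hmem y).2 ⟨mem_of_mem hy h1, h2.mem hy⟩
  obtain ⟨α, ⟨hα, hord, hαP⟩, hmin⟩ := ZFSet.mem_wf.has_min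
    {α | α ∈ V ∧ α.IsOrdinal ∧ img G α = P} hex
  have hGα : ∀ β ∈ α, G β ∈ P ∧ G β ∉ img G β := by
    intro β hβ
    refine hstep β (mem_of_mem hβ hα) (hord.mem hβ) fun γ hγ e => ?_
    have hγα := succ_subset hord hβ hγ
    exact hmin γ ⟨mem_of_mem hγα hα, hord.mem hγα, e⟩ hγα
  have hg := lam_memRec_mem hc' hord hα
  have := Fact.mk hg
  have hinj' : ∀ β ∈ α, ∀ γ ∈ α, G β = G γ → β = γ := fun β hβ γ hγ =>
    hinj β γ (hord.mem hβ) (hord.mem hγ) (hGα β hβ).2 (hGα γ hγ).2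
  refine ⟨α, hα, hord, cardLE_of_relation
    (R := fun p β => ZFSet.pair β p ∈ lam α (memRec (app c))) hP hα inferInstance ?_ ?_,
    cardLE_of_app hα hg (fun x hx => ?_) fun x hx y hy => ?_⟩
  · intro p hp
    rw [← hαP] at hp
    obtain ⟨β, hβ, rfl⟩ := mem_img.1 hp
    exact ⟨β, hβ, pair_mem_lam.2 ⟨hβ, rfl⟩⟩
  · intro p _ q _ β h1 h2
    exact (pair_mem_lam.1 h1).2.symm.trans (pair_mem_lam.1 h2).2
  · rw [app_lam hx]
    exact (hGα x hx).1
  · rw [app_lam hx, app_lam hy]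
    exact hinj' x hx y hy

/-- `SequenceCovering` speaks only of cardinals `μ` with this property, so one must exist: the least
ordinal of `V` bounding the size of a cofinal family. -/
theorem exists_isClubCofinality {θ : ZFSet.{u}} (hθ : θ ∈ V) : ∃ μ, IsClubCofinality V θ μ := by
  have := Fact.mk hθ
  have hex : ∃ α ∈ V, α.IsOrdinal ∧ ∃ P, IsCofinalClubFamily V θ P ∧ CardLE V P α := by
    have hP : ZFSet.sep (fun E => IsClub E θ) (powersetIn V θ) ∈ V := mem_model _
    obtain ⟨α, hα, hord, hle, -⟩ := exists_ordinal_equiv hP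
    refine ⟨α, hα, hord, _, ⟨hP, fun E hE => ⟨mem_of_mem hE hP, (ZFSet.mem_sep.1 hE).2⟩,
      fun E hE => ⟨E, ZFSet.mem_sep.2 ⟨mem_powersetIn.2 ⟨hE.2.1.1, hE.1⟩, hE.2⟩, subset_rfl⟩⟩, hle⟩
  obtain ⟨μ, ⟨hμ, hord, P, hP, hPμ⟩, hmin⟩ := ZFSet.mem_wf.has_min
    {α | α ∈ V ∧ α.IsOrdinal ∧ ∃ P, IsCofinalClubFamily V θ P ∧ CardLE V P α} hex
  refine ⟨μ, ⟨hμ, hord, fun α hα hle => ?_⟩, ⟨P, hP, hPμ⟩, fun Q hQ => ?_⟩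
  · exact hmin α ⟨mem_of_mem hα hμ, hord.mem hα, P, hP, hPμ.trans hP.1 hle⟩ hα
  · obtain ⟨α, hα, hαo, h1, h2⟩ := exists_ordinal_equiv hQ.1
    refine (cardLE_of_subset hμ ?_).trans hμ h2
    exact (hαo.notMem_iff_subset hord).1 fun h => hmin α ⟨hα, hαo, Q, hQ, h1⟩ h

end InnerModels

/-! ### Uncountable cofinality. -/

namespace InnerModels
open Set FirstOrder

/-- The clubs of `κ` in `V`, as a set. -/
noncomputable def clubSet (V : Set ZFSet.{u}) (κ : ZFSet.{u}) : ZFSet.{u} :=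
  ZFSet.sep (fun E => IsClub E κ) (powersetIn V κ)

theorem mem_clubSet {V : Set ZFSet.{u}} {κ E : ZFSet.{u}} :
    E ∈ clubSet V κ ↔ E ∈ ClubsOf V κ := by
  rw [clubSet, ZFSet.mem_sep, mem_powersetIn]
  exact ⟨fun h => ⟨h.1.2, h.2⟩, fun h => ⟨⟨h.2.1.1, h.1⟩, h.2⟩⟩

theorem clubSet_mem {V : Set ZFSet.{u}} [Fact (IsTransitiveModel V)] {κ : ZFSet.{u}}
    (hκ : κ ∈ V) : clubSet V κ ∈ V := by
  have := Fact.mk hκ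
  unfold clubSet
  exact mem_model _

variable {V₁ V₂ : Set ZFSet.{u}} [hV₁ : Fact (IsTransitiveModel V₁)]
  [hV₂ : Fact (IsTransitiveModel V₂)] {κ θ : ZFSet.{u}}

theorem exists_guessing_of_sequenceCovering (hsub : V₁ ⊆ V₂)
    (hreg : IsRegularUncountableIn V₁ κ) (hcof : IsCofIn V₂ κ θ) (hlt : θ ∈ κ)
    (hω : ZFSet.omega ∈ θ) (hcov : SequenceCovering V₁ V₂ κ θ) :
    ∃ C ∈ V₂, IsUnboundedIn C κ ∧
      ∀ E ∈ ClubsOf V₁ κ, ∃ α ∈ κ, ∀ β ∈ C, β ∉ E → β ∈ α := by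
  have hκ : κ ∈ V₂ := hsub hreg.1.1
  have hord := hreg.1.2.1
  have hθ : θ ∈ V₂ := mem_of_mem hlt hκ
  have hK : clubSet V₁ κ ∈ V₂ := hsub (clubSet_mem hreg.1.1)
  have := Fact.mk hκ
  have := Fact.mk hθ
  obtain ⟨A, hA⟩ := hcof.exists_isCofSeq hκ hord (fun x hx => succ_mem_of_isRegular hreg hx) hθ
  have hA' : ∀ (s) [hs : DT V₂ s], DT V₂ (fun v => A (s v)) := fun s hs => hA.definable.comp₁ hs
  have hg' : ∀ (s) [hs : DT V₂ s], DT V₂ (fun v => gsup A (s v)) := fun s hs => by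
    unfold gsup; infer_instance
  by_contra! hcon
  -- Each club `D` of `θ` yields a candidate `{gsup A δ | δ ∈ D}`, which some club of `V₁` refutes.
  have hbad : ∀ D ∈ V₂, IsClub D θ → ∃ E ∈ clubSet V₁ κ,
      ∀ a ∈ κ, ∃ β ∈ img (gsup A) D, β ∉ E ∧ β ∉ a := by
    intro D hD hcl
    have := Fact.mk hD
    have hunb : IsUnboundedIn (img (gsup A) D) κ := by
      refine ⟨fun x hx => ?_, fun a ha => ?_⟩
      · obtain ⟨δ, hδ, rfl⟩ := mem_img.1 hx
        exact hA.gsup_mem (hcl.1.1 hδ)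
      · obtain ⟨i, hi, hai⟩ := hA.cofinal a ha
        obtain ⟨δ, hδ, hiδ⟩ := hcl.1.2 i hi
        exact ⟨_, mem_img.2 ⟨δ, hδ, rfl⟩, mem_gsup.2 ⟨i, hiδ, hai⟩⟩
    obtain ⟨E, hE, h⟩ := hcon (img (gsup A) D) (mem_model _) hunb
    exact ⟨E, mem_clubSet.2 hE, h⟩
  obtain ⟨μ, hμ⟩ := exists_isClubCofinality hθ
  obtain ⟨P, hP, hPμ⟩ := hμ.2.1
  have := Fact.mk hP.1
  obtain ⟨e, he, heP⟩ := exists_choice hP.1 hK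
    (R := fun D E => ∀ a ∈ κ, ∃ β ∈ img (gsup A) D, β ∉ E ∧ β ∉ a) inferInstance
    fun D hD => hbad D (hP.2.1 D hD).1 (hP.2.1 D hD).2
  have := Fact.mk he
  have haV : img (app e) P ∈ V₂ := mem_model _
  obtain ⟨B, hB, g, hg, hgf, hgb, hga⟩ := hcov μ hμ (img (app e) P) haV (fun E hE => by
    obtain ⟨D, hD, rfl⟩ := mem_img.1 hE
    exact mem_clubSet.1 (heP D hD).1) ((cardLE_img hP.1 inferInstance).trans haV hPμ)
  have := Fact.mk hg
  -- Each pseudo-intersection is found in `V₁`; the sequence of them is chosen in `V₂`.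
  obtain ⟨f, hf, hfF⟩ := exists_choice hθ hK
    (R := fun i F => ∀ E ∈ app g i, IsClub E κ → ∃ m ∈ κ, ∀ β ∈ F, β ∉ E → β ∈ m)
    inferInstance fun i hi => by
      obtain ⟨hb, hbc⟩ := hgb i (app g i) (hgf.pair_app_mem hi)
      obtain ⟨F, hF, h⟩ := exists_pseudointersection hreg hb hbc
      exact ⟨F, mem_clubSet.2 hF, h⟩
  have := Fact.mk hf
  obtain ⟨D, hD, hDcl, hDf⟩ := hA.exists_diagonal_club hω (E := app f) inferInstance
    fun i hi => (mem_clubSet.1 (hfF i hi).1).2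
  obtain ⟨D', hD', hDD'⟩ := hP.2.2 D ⟨hD, hDcl⟩
  obtain ⟨hE, hEbad⟩ := heP D' hD'
  obtain ⟨i, b, hib, hEb⟩ := hga _ (mem_img.2 ⟨D', hD', rfl⟩)
  obtain ⟨hi, rfl⟩ := hgf.pair_mem_iff.1 hib
  obtain ⟨m, hm, hmF⟩ := (hfF i hi).2 _ hEb (mem_clubSet.1 hE).2
  -- Above `m` the set `F_i` is contained in `E`; above `gsup A i` the index `δ` exceeds `i`, so
  -- `gsup A δ ∈ F_i`.
  obtain ⟨β, hβ, hβE, hβm⟩ := hEbad _ (union_mem_of_isOrdinal hord hm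
    (succ_mem_of_isRegular hreg (hA.gsup_mem hi)))
  obtain ⟨δ, hδ, rfl⟩ := mem_img.1 hβ
  rw [ZFSet.mem_union, not_or] at hβm
  have hδθ := hDcl.1.1 (hDD' hδ)
  rcases (hA.ord_θ.mem hi).mem_or_subset (hA.ord_θ.mem hδθ) with h | h
  · exact hβm.1 (hmF _ (hDf δ (hDD' hδ) i h).1 hβE)
  · refine hβm.2 (ZFSet.mem_insert_iff.2 (((hord.mem (hA.gsup_mem hδθ)).subset_iff_eq_or_mem
      (hord.mem (hA.gsup_mem hi))).1 fun x hx => ?_))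
    obtain ⟨j, hj, hx⟩ := mem_gsup.1 hx
    exact mem_gsup.2 ⟨j, h hj, hx⟩

end InnerModels

/-! ### Least witnesses, and coding sequences of sets of numbers. -/

namespace InnerModels
open Set FirstOrder

section Least

/-- The least element of the ordinal `κ` that satisfies `P`, if there is one. -/
noncomputable def least (κ : ZFSet.{u}) (P : ZFSet.{u} → Prop) : ZFSet.{u} :=
  ZFSet.sep (fun z => ¬ ∃ y ∈ κ, P y ∧ y ⊆ z) κ

theorem least_spec {κ : ZFSet.{u}} (hκ : κ.IsOrdinal) {P : ZFSet.{u} → Prop}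
    (h : ∃ y ∈ κ, P y) : least κ P ∈ κ ∧ P (least κ P) ∧ ∀ y ∈ κ, P y → least κ P ⊆ y := by
  obtain ⟨y, ⟨hy, hPy⟩, hmin⟩ := ZFSet.mem_wf.has_min {y | y ∈ κ ∧ P y} h
  have hle : ∀ z ∈ κ, P z → y ⊆ z := fun z hz hPz =>
    ((hκ.mem hz).notMem_iff_subset (hκ.mem hy)).1 (hmin z ⟨hz, hPz⟩)
  have e : least κ P = y := by
    ext z
    rw [least, ZFSet.mem_sep]
    constructor
    · rintro ⟨hz, h1⟩
      exact ((hκ.mem hy).not_subset_iff_mem (hκ.mem hz)).1 fun h2 => h1 ⟨y, hy, hPy, h2⟩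
    · intro hz
      exact ⟨hκ.mem_trans hz hy, fun ⟨w, hw, hPw, hwz⟩ =>
        ZFSet.mem_irrefl z (hwz (hle w hw hPw hz))⟩
  rw [e]
  exact ⟨hy, hPy, hle⟩

instance DT.least {V : Set ZFSet.{u}} [Fact (IsTransitiveModel V)]
    {a : (ℕ → ZFSet.{u}) → ZFSet.{u}} [ha : DT V a] {P : ZFSet.{u} → (ℕ → ZFSet.{u}) → Prop}
    [hP : D V (fun v => P (v 0) (fun i => v (i + 1)))] :
    DT V (fun v => least (a v) (fun z => P z v)) := by
  have := hP.reindex fun i => Nat.casesOn i 0 fun j => j + 2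
  have : D V (fun v => ∃ y ∈ a (fun i => v (i + 1)), P y (fun i => v (i + 1)) ∧ y ⊆ v 0) :=
    D.exMem (P := fun y v => P y (fun i => v (i + 1)) ∧ y ⊆ v 0)
      (hP := D.and (P := fun v => P (v 0) (fun i => v (i + 2))) (Q := fun v => v 0 ⊆ v 1))
  exact DT.sep (P := fun z v => ¬ ∃ y ∈ a v, P y v ∧ y ⊆ z) (hP := D.not)

end Least

theorem isOrdinal_sUnion {x : ZFSet.{u}} (h : ∀ y ∈ x, y.IsOrdinal) : (ZFSet.sUnion x).IsOrdinal := by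
  have := isOrdinal_sUnion_img (F := fun y => y) h
  rwa [show img (fun y => y) x = x by ext; simp] at this

section Pairing

variable {V : Set ZFSet.{u}} [hV : Fact (IsTransitiveModel V)]

/-- Cantor's walk along the diagonals, `(a, 0) ↦ (0, a + 1)` and `(a, b + 1) ↦ (a + 1, b)`, reaches
every pair from `(0, 0)`. A pair is sent to a time at which it is visited. -/
theorem cardLE_omega_prod (hω : ZFSet.omega ∈ V) :
    CardLE V (ZFSet.prod ZFSet.omega ZFSet.omega) ZFSet.omega := by
  have := Fact.mk hω
  have hω2 : ZFSet.prod ZFSet.omega ZFSet.omega ∈ V := mem_model _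
  obtain ⟨s, hs, hsR⟩ := exists_choice hω2 hω2
    (R := fun p q => (∃ a ∈ ZFSet.omega, p = ZFSet.pair a ∅ ∧ q = ZFSet.pair ∅ (insert a a)) ∨
      ∃ a ∈ ZFSet.omega, ∃ b ∈ ZFSet.omega, p = ZFSet.pair a (insert b b) ∧
        q = ZFSet.pair (insert a a) b) inferInstance (by
    intro p hp
    obtain ⟨a, ha, b, hb, rfl⟩ := ZFSet.mem_prod.1 hp
    obtain ⟨n, rfl⟩ := mem_omega_iff.1 hb
    cases n with
    | zero => exact ⟨_, ZFSet.pair_mem_prod.2 ⟨ZFSet.omega_zero, ZFSet.omega_succ ha⟩,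
        Or.inl ⟨a, ha, rfl, rfl⟩⟩
    | succ n => exact ⟨_, ZFSet.pair_mem_prod.2 ⟨ZFSet.omega_succ ha, nat_mem_omega n⟩,
        Or.inr ⟨a, ha, _, nat_mem_omega n, rfl, rfl⟩⟩)
  have := Fact.mk hs
  have hmem : ∀ a b : ℕ, ZFSet.pair (nat a) (nat b) ∈ ZFSet.prod ZFSet.omega ZFSet.omega.{u} :=
    fun a b => ZFSet.pair_mem_prod.2 ⟨nat_mem_omega a, nat_mem_omega b⟩
  have hne : ∀ b : ZFSet.{u}, insert b b ≠ ∅ := fun b e =>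
    ZFSet.notMem_empty b (e.subset (ZFSet.mem_insert b b))
  have hs0 : ∀ a : ℕ, app s (ZFSet.pair (nat a) (nat 0)) = ZFSet.pair (nat 0) (nat (a + 1)) := by
    intro a
    rcases (hsR _ (hmem a 0)).2 with ⟨a', _, e, h⟩ | ⟨a', _, b', _, e, h⟩
    · rw [h, ← (ZFSet.pair_inj.1 e).1]
      rfl
    · exact (hne _ (ZFSet.pair_inj.1 e).2.symm).elim
  have hs1 : ∀ a b : ℕ, app s (ZFSet.pair (nat a) (nat (b + 1))) =
      ZFSet.pair (nat (a + 1)) (nat b) := by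
    intro a b
    rcases (hsR _ (hmem a (b + 1))).2 with ⟨a', _, e, h⟩ | ⟨a', _, b', hb', e, h⟩
    · exact (hne _ (ZFSet.pair_inj.1 e).2).elim
    · obtain ⟨m, rfl⟩ := mem_omega_iff.1 hb'
      obtain ⟨e1, e2⟩ := ZFSet.pair_inj.1 e
      have e3 : b + 1 = m + 1 := nat_injective e2
      obtain rfl : b = m := by omega
      rw [h, ← e1]
      rfl
  obtain ⟨f, hf, hfn⟩ := exists_iterate hω hω2 (hmem 0 0) (H := app s) inferInstance
    fun p hp => (hsR p hp).1
  have := Fact.mk hf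
  have hdiag : ∀ (a b n : ℕ), (app s)^[n] (ZFSet.pair (nat 0) (nat 0)) =
      ZFSet.pair (nat 0) (nat (a + b)) →
      (app s)^[n + a] (ZFSet.pair (nat 0) (nat 0)) = ZFSet.pair (nat a) (nat b) := by
    intro a
    induction a with
    | zero => intro b n h; simpa using h
    | succ a ih =>
      intro b n h
      rw [← Nat.add_assoc, Function.iterate_succ_apply', ih (b + 1) n, hs1]
      rw [h]
      congr 2
      omega
  have hrow : ∀ k : ℕ, ∃ n, (app s)^[n] (ZFSet.pair (nat 0) (nat 0)) =
      ZFSet.pair (nat 0) (nat k) := by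
    intro k
    induction k with
    | zero => exact ⟨0, rfl⟩
    | succ k ih =>
      obtain ⟨n, hn⟩ := ih
      refine ⟨n + k + 1, ?_⟩
      rw [Function.iterate_succ_apply', hdiag k 0 n hn, hs0]
  refine cardLE_of_relation (R := fun p n => app f n = p) hω2 hω inferInstance ?_ ?_
  · intro p hp
    obtain ⟨_, ha, _, hb, rfl⟩ := ZFSet.mem_prod.1 hp
    obtain ⟨a, rfl⟩ := mem_omega_iff.1 ha
    obtain ⟨b, rfl⟩ := mem_omega_iff.1 hb
    obtain ⟨n, hn⟩ := hrow (a + b)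
    exact ⟨nat (n + a), nat_mem_omega _, by rw [hfn, hdiag a b n hn]⟩
  · rintro _ _ _ _ n rfl rfl
    rfl

/-- A code for the number `n` and the sequence `c` of sets of numbers, where `j` is an injection of
`ω × ω` into `ω`. -/
noncomputable def code (j c n : ZFSet.{u}) : ZFSet.{u} :=
  ZFSet.sep (fun z => z = app j (ZFSet.pair (nat 0) ∅) ∨ z = app j (ZFSet.pair (nat 1) n) ∨
    ∃ k ∈ ZFSet.omega, ∃ m ∈ app c k,
      z = app j (ZFSet.pair (insert (insert k k) (insert k k)) m)) ZFSet.omega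

instance DT.nat (n : ℕ) : DT V (fun _ => nat n) := by
  induction n with
  | zero => exact DT.empty
  | succ n ih => unfold InnerModels.nat; infer_instance

theorem DT.code (hω : ZFSet.omega ∈ V) {r s t : (ℕ → ZFSet.{u}) → ZFSet.{u}} (hr : DT V r)
    (hs : DT V s) (ht : DT V t) : DT V (fun v => code (r v) (s v) (t v)) := by
  have := Fact.mk hω
  unfold InnerModels.code
  infer_instance

section

variable {j : ZFSet.{u}}
  (hj : ∀ p ∈ ZFSet.prod ZFSet.omega ZFSet.omega, app j p ∈ ZFSet.omega)
  (hinj : ∀ p ∈ ZFSet.prod ZFSet.omega ZFSet.omega, ∀ q ∈ ZFSet.prod ZFSet.omega ZFSet.omega,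
    app j p = app j q → p = q)

include hj in
theorem mem_code {c n z : ZFSet.{u}} (hc : ∀ k ∈ ZFSet.omega, app c k ⊆ ZFSet.omega)
    (hn : n ∈ ZFSet.omega) : z ∈ code j c n ↔ z = app j (ZFSet.pair (nat 0) ∅) ∨
      z = app j (ZFSet.pair (nat 1) n) ∨
      ∃ k : ℕ, ∃ m ∈ app c (nat k), z = app j (ZFSet.pair (nat (k + 2)) m) := by
  rw [code, ZFSet.mem_sep]
  constructor
  · rintro ⟨-, h | h | ⟨_, hk, m, hm, h⟩⟩
    · exact Or.inl h
    · exact Or.inr (Or.inl h)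
    · obtain ⟨k, rfl⟩ := mem_omega_iff.1 hk
      exact Or.inr (Or.inr ⟨k, m, hm, h⟩)
  · rintro (rfl | rfl | ⟨k, m, hm, rfl⟩)
    · exact ⟨hj _ (ZFSet.pair_mem_prod.2 ⟨nat_mem_omega 0, ZFSet.omega_zero⟩), Or.inl rfl⟩
    · exact ⟨hj _ (ZFSet.pair_mem_prod.2 ⟨nat_mem_omega 1, hn⟩), Or.inr (Or.inl rfl)⟩
    · exact ⟨hj _ (ZFSet.pair_mem_prod.2 ⟨nat_mem_omega _, hc _ (nat_mem_omega k) hm⟩),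
        Or.inr (Or.inr ⟨_, nat_mem_omega k, m, hm, rfl⟩)⟩

include hinj in
theorem app_pair_nat_injective {a b : ℕ} {m n : ZFSet.{u}} (hm : m ∈ ZFSet.omega)
    (hn : n ∈ ZFSet.omega) (h : app j (ZFSet.pair (nat a) m) = app j (ZFSet.pair (nat b) n)) :
    a = b ∧ m = n := by
  have := ZFSet.pair_inj.1 (hinj _ (ZFSet.pair_mem_prod.2 ⟨nat_mem_omega a, hm⟩) _
    (ZFSet.pair_mem_prod.2 ⟨nat_mem_omega b, hn⟩) h)
  exact ⟨nat_injective this.1, this.2⟩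

include hj hinj

/-- The points of columns `0` and `1` are distinct. Singletons thus remain free to name the
generators in `exists_closure`. -/
theorem code_ne_singleton {c n x : ZFSet.{u}} (hc : ∀ k ∈ ZFSet.omega, app c k ⊆ ZFSet.omega)
    (hn : n ∈ ZFSet.omega) : code j c n ≠ {x} := by
  intro e
  have h0 := ZFSet.mem_singleton.1 (e.subset ((mem_code hj hc hn).2 (Or.inl rfl)))
  have h1 := ZFSet.mem_singleton.1 (e.subset ((mem_code hj hc hn).2 (Or.inr (Or.inl rfl))))
  have := (app_pair_nat_injective hinj ZFSet.omega_zero hn (h0.trans h1.symm)).1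
  omega

theorem code_subset {c c' n n' : ZFSet.{u}} (hc : ∀ k ∈ ZFSet.omega, app c k ⊆ ZFSet.omega)
    (hn : n ∈ ZFSet.omega) (hc' : ∀ k ∈ ZFSet.omega, app c' k ⊆ ZFSet.omega)
    (hn' : n' ∈ ZFSet.omega) (h : code j c n ⊆ code j c' n') :
    n = n' ∧ ∀ k ∈ ZFSet.omega, app c k ⊆ app c' k := by
  constructor
  · rcases (mem_code hj hc' hn').1 (h ((mem_code hj hc hn).2 (Or.inr (Or.inl rfl)))) with
      h | h | ⟨k, m, hm, h⟩
    · have := (app_pair_nat_injective hinj hn ZFSet.omega_zero h).1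
      omega
    · exact (app_pair_nat_injective hinj hn hn' h).2
    · have := (app_pair_nat_injective hinj hn (hc' _ (nat_mem_omega k) hm) h).1
      omega
  · intro k hk m hm
    have hmω := hc k hk hm
    obtain ⟨k, rfl⟩ := mem_omega_iff.1 hk
    rcases (mem_code hj hc' hn').1 (h ((mem_code hj hc hn).2 (Or.inr (Or.inr ⟨k, m, hm, rfl⟩))))
      with h | h | ⟨k', m', hm', h⟩
    · have := (app_pair_nat_injective hinj hmω ZFSet.omega_zero h).1
      omega
    · have := (app_pair_nat_injective hinj hmω hn' h).1
      omega
    · obtain ⟨e, rfl⟩ := app_pair_nat_injective hinj hmω (hc' _ (nat_mem_omega k') hm') h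
      obtain rfl : k = k' := by omega
      exact hm'

theorem code_injective {c c' n n' : ZFSet.{u}} (hc : ∀ k ∈ ZFSet.omega, app c k ⊆ ZFSet.omega)
    (hn : n ∈ ZFSet.omega) (hc' : ∀ k ∈ ZFSet.omega, app c' k ⊆ ZFSet.omega)
    (hn' : n' ∈ ZFSet.omega) (h : code j c n = code j c' n') :
    n = n' ∧ ∀ k ∈ ZFSet.omega, app c k = app c' k :=
  ⟨(code_subset hj hinj hc hn hc' hn' h.subset).1, fun k hk => subset_antisymm
    ((code_subset hj hinj hc hn hc' hn' h.subset).2 k hk)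
    ((code_subset hj hinj hc' hn' hc hn h.symm.subset).2 k hk)⟩

end

end Pairing

end InnerModels

/-! ### Closure under operations on countable sequences. -/

namespace InnerModels
open Set FirstOrder

theorem DT.comp₂ {V : Set ZFSet.{u}} {F : ZFSet.{u} → ZFSet.{u} → ZFSet.{u}}
    (hF : DT V (fun v => F (v 0) (v 1))) {s t : (ℕ → ZFSet.{u}) → ZFSet.{u}} (hs : DT V s)
    (ht : DT V t) : DT V (fun v => F (s v) (t v)) := by
  refine ⟨fun v hv => hF.mem (fun i => Nat.casesOn i (s v) fun _ => t v) fun i => ?_, ?_⟩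
  · cases i
    exacts [hs.mem v hv, ht.mem v hv]
  · refine D.bind (hs.reindex (· + 1)) (P := fun x v => v 0 = F x (t fun i => v (i + 1))) ?_
    refine D.bind (ht.reindex (· + 2)) (P := fun y v => v 1 = F (v 0) y) ?_
    exact hF.graph.reindex fun i => Nat.casesOn i 2 fun i => Nat.casesOn i 1 fun _ => 0

/-- The set of functions from `ω` to `κ` in `V`. -/
noncomputable def seqSet (V : Set ZFSet.{u}) (κ : ZFSet.{u}) : ZFSet.{u} :=
  ZFSet.sep (fun x => ZFSet.IsFunc ZFSet.omega κ x) (powersetIn V (ZFSet.prod ZFSet.omega κ))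

theorem mem_seqSet {V : Set ZFSet.{u}} {κ x : ZFSet.{u}} :
    x ∈ seqSet V κ ↔ x ∈ V ∧ ZFSet.IsFunc ZFSet.omega κ x := by
  rw [seqSet, ZFSet.mem_sep, mem_powersetIn]
  exact ⟨fun h => ⟨h.1.2, h.2⟩, fun h => ⟨⟨h.2.1, h.1⟩, h.2⟩⟩

section

variable {V : Set ZFSet.{u}} [hV : Fact (IsTransitiveModel V)]

theorem seqSet_mem (hω : ZFSet.omega ∈ V) {κ : ZFSet.{u}} (hκ : κ ∈ V) : seqSet V κ ∈ V := by
  have := Fact.mk hκ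
  have := Fact.mk hω
  unfold seqSet
  exact mem_model _

/-- Closing off a countable set under `ω`-ary operations yields a set `X` with at most `2 ^ ℵ₀`
countable sequences, in `V`. -/
theorem exists_closure (hω : ZFSet.omega ∈ V) {κ : ZFSet.{u}} (hκ : κ ∈ V)
    {A : ZFSet.{u} → ZFSet.{u}} (hA : DT V (fun v => A (v 0)))
    (hAκ : ∀ n ∈ ZFSet.omega, A n ∈ κ)
    {Φ : ZFSet.{u} → ZFSet.{u} → ZFSet.{u}} (hΦ : DT V (fun v => Φ (v 0) (v 1)))
    (hΦκ : ∀ x ∈ seqSet V κ, ∀ n ∈ ZFSet.omega, Φ x n ∈ κ) :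
    ∃ X ∈ V, (∀ n ∈ ZFSet.omega, A n ∈ X) ∧
      (∀ x ∈ seqSet V κ, (∀ k ∈ ZFSet.omega, app x k ∈ X) → ∀ n ∈ ZFSet.omega, Φ x n ∈ X) ∧
      CardLE V (ZFSet.sep (fun x => ∀ k ∈ ZFSet.omega, app x k ∈ X) (seqSet V κ))
        (powersetIn V ZFSet.omega) := by
  have := Fact.mk hω
  have := Fact.mk hκ
  have hW := seqSet_mem hω hκ
  have := Fact.mk hW
  have hA' : ∀ (s) [hs : DT V s], DT V (fun v => A (s v)) := fun s hs => hA.comp₁ hs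
  have hΦ' : ∀ (s t) [hs : DT V s] [ht : DT V t], DT V (fun v => Φ (s v) (t v)) :=
    fun s t hs ht => hΦ.comp₂ hs ht
  obtain ⟨j, hjV, hj, hinj⟩ := (cardLE_omega_prod hω).exists_app
  have := Fact.mk hjV
  have hJ' : ∀ (r s t) [hr : DT V r] [hs : DT V s] [ht : DT V t],
      DT V (fun v => code (r v) (s v) (t v)) := fun r s t hr hs ht => DT.code hω hr hs ht
  let T := powersetIn V ZFSet.omega
  have hT : T ∈ V := mem_model _
  -- Elements of the closure get subsets of `ω` as names: `{n}` names `A n`, and if each `c k` names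
  -- `x k`, then `code j c n` names `Φ x n`. The least such relation `R` replaces a transfinite
  -- construction.
  let Cl : ZFSet.{u} → Prop := fun S => (∀ n ∈ ZFSet.omega, ZFSet.pair {n} (A n) ∈ S) ∧
    ∀ c ∈ V, ∀ x ∈ seqSet V κ, (∀ k ∈ ZFSet.omega, ZFSet.pair (app c k) (app x k) ∈ S) →
      ∀ n ∈ ZFSet.omega, ZFSet.pair (code j c n) (Φ x n) ∈ S
  let R := ZFSet.sep (fun p => ∀ S ∈ powersetIn V (ZFSet.prod T κ), Cl S → p ∈ S)
    (ZFSet.prod T κ)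
  have hR : R ∈ V := mem_model _
  have := Fact.mk hR
  have hRT : ∀ t y, ZFSet.pair t y ∈ R → t ⊆ ZFSet.omega ∧ t ∈ V ∧ y ∈ κ := by
    intro t y h
    obtain ⟨h1, h2⟩ := ZFSet.pair_mem_prod.1 (ZFSet.mem_sep.1 h).1
    exact ⟨(mem_powersetIn.1 h1).1, (mem_powersetIn.1 h1).2, h2⟩
  have hRCl : Cl R := by
    constructor
    · intro n hn
      have := Fact.mk (mem_of_mem hn hω)
      refine ZFSet.mem_sep.2 ⟨ZFSet.pair_mem_prod.2 ⟨mem_powersetIn.2 ⟨fun z hz => ?_,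
        mem_model _⟩, hAκ n hn⟩, fun S _ hS => hS.1 n hn⟩
      rwa [ZFSet.mem_singleton.1 hz]
    · intro c hc x hx h n hn
      have := Fact.mk (mem_of_mem hn hω)
      have := Fact.mk hc
      exact ZFSet.mem_sep.2 ⟨ZFSet.pair_mem_prod.2 ⟨mem_powersetIn.2 ⟨ZFSet.sep_subset,
        mem_model _⟩, hΦκ x hx n hn⟩, fun S hSV hS => hS.2 c hc x hx
          (fun k hk => (ZFSet.mem_sep.1 (h k hk)).2 S hSV hS) n hn⟩
  have hind : ∀ Q : ZFSet.{u} → Prop, D V (fun v => Q (v 0)) →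
      Cl (ZFSet.sep Q R) → ∀ p ∈ R, Q p := by
    intro Q hQ hcl p hp
    have hQ' : ∀ (s) [hs : DT V s], D V (fun v => Q (s v)) := fun s hs => hQ.comp₁ hs
    exact (ZFSet.mem_sep.1 ((ZFSet.mem_sep.1 hp).2 (ZFSet.sep Q R) (mem_powersetIn.2
      ⟨fun z hz => (ZFSet.mem_sep.1 (ZFSet.mem_sep.1 hz).1).1, mem_model _⟩) hcl)).2
  -- Inversion: each pair in `R` comes from one of the two rules.
  let Inv : ZFSet.{u} → Prop := fun p => (∃ n ∈ ZFSet.omega, p = ZFSet.pair {n} (A n)) ∨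
    ∃ c ∈ V, ∃ x ∈ seqSet V κ, (∀ k ∈ ZFSet.omega, ZFSet.pair (app c k) (app x k) ∈ R) ∧
      ∃ n ∈ ZFSet.omega, p = ZFSet.pair (code j c n) (Φ x n)
  set_option synthInstance.maxSize 2000 in
  have hInv : D V (fun v => Inv (v 0)) := inferInstance
  have hinv : ∀ p ∈ R, Inv p := by
    refine hind _ hInv ⟨fun n hn => ZFSet.mem_sep.2 ⟨hRCl.1 n hn,
      Or.inl ⟨n, hn, rfl⟩⟩, fun c hc x hx h n hn => ?_⟩
    have h' := fun k hk => (ZFSet.mem_sep.1 (h k hk)).1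
    exact ZFSet.mem_sep.2 ⟨hRCl.2 c hc x hx h' n hn, Or.inr ⟨c, hc, x, hx, h', n, hn, rfl⟩⟩
  have hsub : ∀ c x, (∀ k ∈ ZFSet.omega, ZFSet.pair (app c k) (app x k) ∈ R) →
      ∀ k ∈ ZFSet.omega, app c k ⊆ ZFSet.omega := fun c x h k hk => (hRT _ _ (h k hk)).1
  -- A name has only one value: the form of the name determines the rule, and injectivity of `code`
  -- recovers the names of the arguments.
  let Fn : ZFSet.{u} → Prop := fun p => ∀ t ∈ V, ∀ y ∈ V, p = ZFSet.pair t y →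
    ∀ y' ∈ V, ZFSet.pair t y' ∈ R → y = y'
  have hFn : D V (fun v => Fn (v 0)) := inferInstance
  have hfun' : ∀ p ∈ R, Fn p := by
    refine hind _ hFn ⟨fun n hn => ZFSet.mem_sep.2 ⟨hRCl.1 n hn, ?_⟩,
      fun c hc x hx h n hn => ?_⟩
    · intro t _ y _ e y' _ hy'
      obtain ⟨rfl, rfl⟩ := ZFSet.pair_inj.1 e
      rcases hinv _ hy' with ⟨m, _, e⟩ | ⟨c, _, x, _, h, m, hm, e⟩
      · obtain ⟨e1, rfl⟩ := ZFSet.pair_inj.1 e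
        rw [ZFSet.singleton_inj.1 e1]
      · exact (code_ne_singleton hj hinj (hsub c x h) hm (ZFSet.pair_inj.1 e).1.symm).elim
    · have h' := fun k hk => (ZFSet.mem_sep.1 (h k hk)).1
      refine ZFSet.mem_sep.2 ⟨hRCl.2 c hc x hx h' n hn, ?_⟩
      intro t _ y _ e y' _ hy'
      obtain ⟨rfl, rfl⟩ := ZFSet.pair_inj.1 e
      rcases hinv _ hy' with ⟨m, _, e⟩ | ⟨c', _, x', hx', h'', m, hm, e⟩
      · exact (code_ne_singleton hj hinj (hsub c x h') hn (ZFSet.pair_inj.1 e).1).elim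
      · obtain ⟨e1, rfl⟩ := ZFSet.pair_inj.1 e
        obtain ⟨rfl, e2⟩ := code_injective hj hinj (hsub c x h') hn (hsub c' x' h'') hm e1
        suffices x = x' by rw [this]
        refine (mem_seqSet.1 hx).2.ext (mem_seqSet.1 hx').2 fun k hk => ?_
        have h1 := h'' k hk
        rw [← e2 k hk] at h1
        exact (ZFSet.mem_sep.1 (h k hk)).2 _ (hRT _ _ h1).2.1 _
          (mem_of_mem (hRT _ _ (h' k hk)).2.2 hκ) rfl _ (mem_of_mem (hRT _ _ h1).2.2 hκ) h1
  have hfun : ∀ t y y', ZFSet.pair t y ∈ R → ZFSet.pair t y' ∈ R → y = y' := fun t y y' h h' =>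
    hfun' _ h t (hRT _ _ h).2.1 y (mem_of_mem (hRT _ _ h).2.2 hκ) rfl y'
      (mem_of_mem (hRT _ _ h').2.2 hκ) h'
  let X := ZFSet.sep (fun y => ∃ t ∈ T, ZFSet.pair t y ∈ R) κ
  have hX : X ∈ V := mem_model _
  have := Fact.mk hX
  have hXR : ∀ t y, ZFSet.pair t y ∈ R → y ∈ X := fun t y h => by
    obtain ⟨h1, h2⟩ := ZFSet.pair_mem_prod.1 (ZFSet.mem_sep.1 h).1
    exact ZFSet.mem_sep.2 ⟨h2, t, h1, h⟩
  have hcodes : ∀ x ∈ seqSet V κ, (∀ k ∈ ZFSet.omega, app x k ∈ X) →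
      ∃ c ∈ V, ∀ k ∈ ZFSet.omega, ZFSet.pair (app c k) (app x k) ∈ R := by
    intro x hx h
    have := Fact.mk (mem_of_mem hx hW)
    obtain ⟨c, hc, h1⟩ := exists_choice hω hT
      (R := fun k t => ZFSet.pair t (app x k) ∈ R) inferInstance fun k hk =>
        (ZFSet.mem_sep.1 (h k hk)).2
    exact ⟨c, hc, fun k hk => (h1 k hk).2⟩
  refine ⟨X, hX, fun n hn => hXR _ _ (hRCl.1 n hn), fun x hx h n hn => ?_, ?_⟩
  · obtain ⟨c, hc, h1⟩ := hcodes x hx h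
    exact hXR _ _ (hRCl.2 c hc x hx h1 n hn)
  -- A sequence in `X` is determined by a sequence of names, which a single subset of `ω` codes; the
  -- number slot is filled by `∅`.
  · refine cardLE_of_relation (R := fun x t => ∃ c ∈ V,
      (∀ k ∈ ZFSet.omega, ZFSet.pair (app c k) (app x k) ∈ R) ∧ t = code j c ∅) (mem_model _) hT
      inferInstance ?_ ?_
    · intro x hx
      obtain ⟨hx, h⟩ := ZFSet.mem_sep.1 hx
      obtain ⟨c, hc, h1⟩ := hcodes x hx h
      have := Fact.mk hc
      exact ⟨code j c ∅, mem_powersetIn.2 ⟨ZFSet.sep_subset, mem_model _⟩, c, hc, h1, rfl⟩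
    · rintro x hx x' hx' t ⟨c, hc, h, rfl⟩ ⟨c', hc', h', e⟩
      refine (mem_seqSet.1 (ZFSet.mem_sep.1 hx).1).2.ext
        (mem_seqSet.1 (ZFSet.mem_sep.1 hx').1).2 fun k hk => ?_
      have e2 := (code_injective hj hinj (hsub c x h) ZFSet.omega_zero (hsub c' x' h')
        ZFSet.omega_zero e).2 k hk
      have h1 := h' k hk
      rw [← e2] at h1
      exact hfun _ _ _ (h k hk) h1

end

/-! ### Countable cofinality. -/

variable {V₁ V₂ : Set ZFSet.{u}} [hV₁ : Fact (IsTransitiveModel V₁)]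
  [hV₂ : Fact (IsTransitiveModel V₂)] {κ : ZFSet.{u}}

theorem exists_guessing_of_setCovering (hsub : V₁ ⊆ V₂)
    (hreg : IsRegularUncountableIn V₁ κ) (hcof : IsCofIn V₂ κ ZFSet.omega)
    (hcov : SetCovering V₁ V₂ κ ZFSet.omega) :
    ∃ C ∈ V₂, IsUnboundedIn C κ ∧
      ∀ E ∈ ClubsOf V₁ κ, ∃ α ∈ κ, ∀ β ∈ C, β ∉ E → β ∈ α := by
  have hκ : κ ∈ V₂ := hsub hreg.1.1
  have hord := hreg.1.2.1
  have hlim : ∀ x ∈ κ, insert x x ∈ κ := fun x hx => succ_mem_of_isRegular hreg hx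
  have hω : ZFSet.omega ∈ V₂ := mem_of_mem hreg.2.1 hκ
  have hK : clubSet V₁ κ ∈ V₂ := hsub (clubSet_mem hreg.1.1)
  have hW := seqSet_mem hω hκ
  have := Fact.mk hκ
  have := Fact.mk hω
  have := Fact.mk hK
  have := Fact.mk hW
  obtain ⟨A, hA⟩ := hcof.exists_isCofSeq hκ hord hlim hω
  have hA' : ∀ (s) [hs : DT V₂ s], DT V₂ (fun v => A (s v)) := fun s hs => hA.definable.comp₁ hs
  let Bad : ZFSet.{u} → ZFSet.{u} → Prop := fun x E =>
    ∀ N ∈ ZFSet.omega, ∃ n ∈ ZFSet.omega, N ⊆ n ∧ app x n ∉ E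
  obtain ⟨e, he, heW⟩ := exists_choice hW hK
    (R := fun x E => (∃ E' ∈ clubSet V₁ κ, Bad x E') → Bad x E) inferInstance fun x _ => by
      by_cases h : ∃ E' ∈ clubSet V₁ κ, Bad x E'
      · obtain ⟨E, hE, hx⟩ := h
        exact ⟨E, hE, fun _ => hx⟩
      -- For a sequence with no bad club, `κ` is a default value.
      · exact ⟨κ, mem_clubSet.2 ⟨hreg.1.1, isClub_self hlim⟩, fun h' => (h h').elim⟩
  have := Fact.mk he
  let Φ : ZFSet.{u} → ZFSet.{u} → ZFSet.{u} := fun x n => ZFSet.sUnion (app e x ∩ app x n)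
  obtain ⟨X, hX, hAX, hΦX, hcard⟩ := exists_closure hω hκ hA.definable hA.maps
    (Φ := Φ) inferInstance (by
      intro x hx n hn
      have hxn := (mem_seqSet.1 hx).2.app_mem hn
      have hordn := hord.mem hxn
      refine (isOrdinal_sUnion fun y hy => hordn.mem (ZFSet.mem_inter.1 hy).2).mem_of_subset_of_mem
        hord (y := app x n) (fun z hz => ?_) hxn
      obtain ⟨y, hy, hz⟩ := ZFSet.mem_sUnion.1 hz
      exact hordn.mem_trans hz (ZFSet.mem_inter.1 hy).2)
  have := Fact.mk hX
  have hWX : ZFSet.sep (fun x => ∀ k ∈ ZFSet.omega, app x k ∈ X) (seqSet V₂ κ) ∈ V₂ :=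
    mem_model _
  have := Fact.mk hWX
  have haV : img (app e) (ZFSet.sep (fun x => ∀ k ∈ ZFSet.omega, app x k ∈ X) (seqSet V₂ κ)) ∈ V₂ :=
    mem_model _
  obtain ⟨b, hb, hab, hbκ⟩ := hcov _ haV (fun E hE => by
    obtain ⟨x, hx, rfl⟩ := mem_img.1 hE
    exact mem_clubSet.1 (heW x (ZFSet.mem_sep.1 hx).1).1)
    ((cardLE_img hWX inferInstance).trans haV hcard)
  obtain ⟨F, hF, hFb⟩ := exists_pseudointersection hreg hb hbκ
  have := Fact.mk (hsub hF.1)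
  -- `q` takes values in `X`, so its club `e q` is among those covered by `b`, although `F` was
  -- found only after the covering.
  let Q : ZFSet.{u} → ZFSet.{u} → Prop := fun n y => y ∈ X ∧ ∃ e ∈ F, A n ⊆ e ∧ e ⊆ y
  let q : ZFSet.{u} → ZFSet.{u} := fun n => least κ (Q n)
  have hq : ∀ n ∈ ZFSet.omega, q n ∈ κ ∧ Q n (q n) ∧ ∀ y ∈ κ, Q n y → q n ⊆ y := by
    intro n hn
    obtain ⟨a, ha, hna⟩ := hF.2.1.2 _ (hA.maps n hn)
    have haκ := hF.2.1.1 ha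
    obtain ⟨m, hm, ham⟩ := hA.cofinal a haκ
    have hmκ := hA.maps m hm
    exact least_spec hord ⟨A m, hmκ, hAX m hm, a, ha, (hord.mem haκ).subset_of_mem hna,
      (hord.mem hmκ).subset_of_mem ham⟩
  have hqmono : ∀ m ∈ ZFSet.omega, ∀ n ∈ ZFSet.omega, m ⊆ n → q m ⊆ q n := by
    intro m hm n hn hmn
    obtain ⟨h1, ⟨h2, a, ha, h3, h4⟩, -⟩ := hq n hn
    exact (hq m hm).2.2 _ h1 ⟨h2, a, ha, fun z hz => h3 (hA.mono m hm n hn hmn hz), h4⟩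
  have hqD : DT V₂ (fun v => q (v 0)) := inferInstance
  have hg : lam ZFSet.omega q ∈ V₂ := mem_model _
  have happ : ∀ n ∈ ZFSet.omega, app (lam ZFSet.omega q) n = q n := fun n hn => app_lam hn
  have hgW : lam ZFSet.omega q ∈ seqSet V₂ κ :=
    mem_seqSet.2 ⟨hg, isFunc_lam fun n hn => (hq n hn).1⟩
  have hgX : ∀ n ∈ ZFSet.omega, app (lam ZFSet.omega q) n ∈ X := fun n hn => by
    rw [happ n hn]
    exact (hq n hn).2.1.1
  refine ⟨img q ZFSet.omega, mem_model _, ⟨fun x hx => ?_, fun a ha => ?_⟩, fun E hE => ?_⟩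
  · obtain ⟨n, hn, rfl⟩ := mem_img.1 hx
    exact (hq n hn).1
  · obtain ⟨n, hn, han⟩ := hA.cofinal a ha
    obtain ⟨-, ⟨-, y, -, h1, h2⟩, -⟩ := hq n hn
    exact ⟨q n, mem_img.2 ⟨n, hn, rfl⟩, h2 (h1 han)⟩
  · have hgood : ¬ Bad (lam ZFSet.omega q) E := by
      intro hbadE
      obtain ⟨hE'K, hbad⟩ := heW _ hgW
      have hbad := hbad ⟨E, mem_clubSet.2 hE, hbadE⟩
      have hE' := (mem_clubSet.1 hE'K).2
      obtain ⟨m, hm, hmF⟩ := hFb _ (hab (mem_img.2 ⟨_, ZFSet.mem_sep.2 ⟨hgW, hgX⟩, rfl⟩)) hE'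
      obtain ⟨N, hN, hmN⟩ := hA.cofinal m hm
      obtain ⟨n, hn, hNn, hqn⟩ := hbad N hN
      rw [happ n hn] at hqn
      obtain ⟨hqκ, ⟨-, a, ha, h1, h2⟩, hmin⟩ := hq n hn
      have haκ := hF.2.1.1 ha
      have hma : m ∈ a := h1 (hA.mono N hN n hn hNn hmN)
      have haE : a ∈ app e (lam ZFSet.omega q) := by
        by_contra hcon
        exact ZFSet.mem_asymm hma (hmF a ha hcon)
      have haq : a ∈ q n := by
        rcases ((hord.mem haκ).subset_iff_eq_or_mem (hord.mem hqκ)).1 h2 with h | h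
        · exact (hqn (h ▸ haE)).elim
        · exact h
      have hs := hΦX _ hgW hgX n hn
      -- The supremum of `e q ∩ q n` lies in `X` and bounds `a ∈ F`, so by minimality it is at least
      -- `q n`.
      have hsq : q n ⊆ Φ (lam ZFSet.omega q) n := by
        have hsκ : Φ (lam ZFSet.omega q) n ⊆ q n := by
          intro z hz
          obtain ⟨y, hy, hz⟩ := ZFSet.mem_sUnion.1 hz
          rw [happ n hn, ZFSet.mem_inter] at hy
          exact (hord.mem hqκ).mem_trans hz hy.2
        have hso : (Φ (lam ZFSet.omega q) n).IsOrdinal := isOrdinal_sUnion fun y hy => by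
          rw [happ n hn, ZFSet.mem_inter] at hy
          exact (hord.mem hqκ).mem hy.2
        refine hmin _ (hso.mem_of_subset_of_mem hord hsκ hqκ) ⟨hs, a, ha, h1, fun z hz => ?_⟩
        exact ZFSet.mem_sUnion.2 ⟨a, ZFSet.mem_inter.2 ⟨haE, by rwa [happ n hn]⟩, hz⟩
      refine hqn (hE'.2 _ hqκ ⟨a, haq⟩ fun z hz => ?_)
      obtain ⟨y, hy, hz⟩ := ZFSet.mem_sUnion.1 (hsq hz)
      rw [happ n hn, ZFSet.mem_inter] at hy
      exact ⟨y, hy.1, hy.2, hz⟩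
    simp only [Bad] at hgood
    push Not at hgood
    obtain ⟨N, hN, hgood⟩ := hgood
    -- From `N` on, `q n` lies in `E`; earlier values are at most `q N`, whence the bound `q N + 1`.
    refine ⟨_, hlim _ (hq N hN).1, fun β hβ hβE => ?_⟩
    obtain ⟨n, hn, rfl⟩ := mem_img.1 hβ
    have hnN : n ⊆ N := by
      rcases (isOrdinal_omega.mem hN).subset_total (isOrdinal_omega.mem hn) with h | h
      · exact (hβE (happ n hn ▸ hgood n hn h)).elim
      · exact h
    exact ZFSet.mem_insert_iff.2 (((hord.mem (hq n hn).1).subset_iff_eq_or_mem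
      (hord.mem (hq N hN).1)).1 (hqmono n hn N hN hnN))

end InnerModels

theorem theorem2p2 (V₁ V₂ : Set ZFSet.{u}) (κ θ : ZFSet.{u})
    (hV₁ : InnerModels.IsTransitiveModel V₁)
    (hV₂ : InnerModels.IsTransitiveModel V₂)
    (hsub : V₁ ⊆ V₂)
    (hord : ∀ α ∈ V₂, α.IsOrdinal → α ∈ V₁)
    (hreg : InnerModels.IsRegularUncountableIn V₁ κ)
    (hcard : InnerModels.IsCardinalIn V₂ κ)
    (hcof : InnerModels.IsCofIn V₂ κ θ)
    (hlt : θ ∈ κ)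
    (hcov :
      (ZFSet.omega ∈ θ ∧ InnerModels.SequenceCovering V₁ V₂ κ θ) ∨
      (θ = ZFSet.omega ∧
        InnerModels.CardLT V₂ (InnerModels.powersetIn V₂ ZFSet.omega) κ ∧
        InnerModels.SetCovering V₁ V₂ κ θ)) :
    ∃ C ∈ V₂, InnerModels.IsUnboundedIn C κ ∧
      ∀ E ∈ InnerModels.ClubsOf V₁ κ, ∃ α ∈ κ, ∀ β ∈ C, β ∉ E → β ∈ α := by
  have := Fact.mk hV₁
  have := Fact.mk hV₂
  rcases hcov with ⟨hω, hcov⟩ | ⟨rfl, -, hcov⟩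
  · exact InnerModels.exists_guessing_of_sequenceCovering hsub hreg hcof hlt hω hcov
  · exact InnerModels.exists_guessing_of_setCovering hsub hreg hcof hcov
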